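/- All graphs are simple and may be infinite, and $r$ is an integer with $r\ge 3$. Let $G$ be a graph. **Definitions.** *Chordality.* A graph is *chordal* if each of its cycles of length at least $4$ has a chord, and *$r$-chordal* if each of its cycles of length at least $4$ and at most $r$ has a chord. The ball $B_G(v,r/2)$ is the subgraph of $G$ formed by all vertices of distance at most $r/2$ from $v$ and all edges of $G$ for which the sum of the distances of the endpoints to $v$ is strictly less than $r$. $G$ is *$r$-locally chordal* if $B_G(v,r/2)$ is chordal for every vertex $v$. A *wheel* $W_n$ $(n\ge4)$ is a cycle of length $n$ together with a further vertex adjacent to every vertex of the cycle. $G$ is *wheel-free* if it has no $W_n$ with $n\ge 4$ as an induced subgraph. *Local cover.* A *covering* of $G$ is a surjective graph homomorphism $p\colon\hat G\to G$ that maps the edges at each vertex $\hat v$ bijectively to the edges at $p(\hat v)$, and for which the preimage of every component of $G$ is connected. It is *$r/2$-ball-preserving* if it restricts to an isomorphism $B_{\hat G}(\hat v,r/2)\to B_G(p(\hat v),r/2)$ for every vertex $\hat v$ of $\hat G$. An *$r$-local covering* $p_r\colon G_r\to G$ is a universal $r/2$-ball-preserving covering: it is an $r/2$-ball-preserving covering,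 and for every $r/2$-ball-preserving covering $p\colon\hat G\to G$ there is a covering $q\colon G_r\to\hat G$ with $p_r=p\circ q$. The graph $G_r$ is then called the *$r$-local cover* of $G$. *Local separators.* Let $X\subseteq V(G)$, and let $\partial X$ be the set of edges of $G$ with exactly one endvertex in $X$. An *$X$-walk* is a walk whose first and last vertices lie in $X$ and which otherwise avoids $X$. A walk is *$r$-local* if it is a walk in a cycle of $G$ of length at most $r$ or traverses a single edge. For $e,f\in\partial X$ write $e\sim_r f$ if $e=f$ or $e,f$ are the first and last edge of an $r$-local $X$-walk. The *$r$-local components* at $X$ are the equivalence classes of the transitive closure of $\sim_r$. Let $u,w$ be vertices of distance $2$ in $G$ with a common neighbour $v$. Then $X$ is an *$r$-local $u$–$w$ separator with respect to $v$* if $u,w\notin X$, $v\in X$, and $uv$ and $vw$ lie in distinct $r$-local components at $X$. A set $X$ is a *minimal $r$-local separator* of $G$ if, for some vertices $u,w$ of distance $2$ and some common neighbour $v$ of them, it is inclusion-minimal among the $r$-local $u$–$w$ separators with respect to $v$. **Theorem.** An $r$-local covering of $G$ exists, and for every $r$-local covering $p_r\colon G_r\to G$ the following are equivalent: 1. $G$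 is $r$-locally chordal; 2. $G$ is $r$-chordal and wheel-free; 3. the $r$-local cover $G_r$ is chordal; 4. every minimal $r$-local separator of $G$ is a clique. -/

import Mathlib

universe u v

namespace SimpleGraph

/-- A graph is chordal if every cycle of length at least four has a chord, that is, an edge
of the graph which joins two vertices of the cycle and is not an edge of the cycle. -/
def IsChordal {V : Type u} (G : SimpleGraph V) : Prop :=
  ∀ (z : V) (c : G.Walk z z), c.IsCycle → 4 ≤ c.length →
    ∃ a ∈ c.support, ∃ b ∈ c.support, G.Adj a b ∧ s(a, b) ∉ c.edges

/-- A graph is `r`-chordal if every cycle of length at least four and at most `r` has a chord. -/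
def IsLengthChordal {V : Type u} (G : SimpleGraph V) (r : ℕ) : Prop :=
  ∀ (z : V) (c : G.Walk z z), c.IsCycle → 4 ≤ c.length → c.length ≤ r →
    ∃ a ∈ c.support, ∃ b ∈ c.support, G.Adj a b ∧ s(a, b) ∉ c.edges

/-- The ball of radius `r / 2` around `x`: its vertices are the vertices of distance at most
`r / 2` from `x`, its edges are the edges `ab` of `G` between such vertices with
`d(x, a) + d(x, b) < r`. -/
def halfBall {V : Type u} (G : SimpleGraph V) (r : ℕ) (x : V) : G.Subgraph where
  verts := {a | 2 * G.edist x a ≤ r}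
  Adj a b := G.Adj a b ∧ 2 * G.edist x a ≤ r ∧ 2 * G.edist x b ≤ r ∧
    G.edist x a + G.edist x b < r
  adj_sub h := h.1
  edge_vert h := h.2.1
  symm := ⟨fun _ _ h => ⟨h.1.symm, h.2.2.1, h.2.1, by rw [add_comm]; exact h.2.2.2⟩⟩

/-- A graph is `r`-locally chordal if all its balls of radius `r / 2` are chordal. -/
def IsLocallyChordal {V : Type u} (G : SimpleGraph V) (r : ℕ) : Prop :=
  ∀ x : V, (G.halfBall r x).coe.IsChordal

/-- The wheel with rim a cycle of length `n` and hub `none`, adjacent to the whole rim. -/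
def wheelGraph (n : ℕ) : SimpleGraph (Option (Fin n)) where
  Adj
    | none, none => False
    | none, some _ => True
    | some _, none => True
    | some i, some j => (cycleGraph n).Adj i j
  symm := ⟨by
    rintro (_ | i) (_ | j) h
    · exact h
    · trivial
    · trivial
    · exact SimpleGraph.Adj.symm h⟩
  loopless := ⟨by
    rintro (_ | i) h
    · exact h
    · exact SimpleGraph.irrefl _ h⟩

/-- A graph is wheel-free if it has no wheel with rim of length at least four as an induced
subgraph. -/
def IsWheelFree {V : Type u} (G : SimpleGraph V) : Prop :=
  ∀ n : ℕ, 4 ≤ n → ¬ (wheelGraph n).IsIndContained G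

/-- A covering of `G`: a surjective homomorphism which maps the edges at every vertex
bijectively to the edges at its image, and for which the preimage of every component is
connected. -/
structure IsCovering {W : Type u} {V : Type v} {H : SimpleGraph W} {G : SimpleGraph V}
    (p : H →g G) : Prop where
  surjective : Function.Surjective p
  bijOn_neighborSet : ∀ x : W, Set.BijOn p (H.neighborSet x) (G.neighborSet (p x))
  connected_preimage : ∀ C : G.ConnectedComponent, (H.induce (p ⁻¹' C.supp)).Connected

/-- A homomorphism is `r / 2`-ball-preserving if it restricts to an isomorphism from the ball of
radius `r / 2` around each vertex to the ball of radius `r / 2` around its image. -/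
def IsBallPreserving {W : Type u} {V : Type v} {H : SimpleGraph W} {G : SimpleGraph V}
    (r : ℕ) (p : H →g G) : Prop :=
  ∀ x : W, Set.BijOn p (H.halfBall r x).verts (G.halfBall r (p x)).verts ∧
    ∀ a ∈ (H.halfBall r x).verts, ∀ b ∈ (H.halfBall r x).verts,
      ((H.halfBall r x).Adj a b ↔ (G.halfBall r (p x)).Adj (p a) (p b))

/-- `p` is the `r`-local covering of `G`, and its domain the `r`-local cover: it is the universal
`r / 2`-ball-preserving covering, that is, it factors through every such covering `p'` of `G` by
a covering `q`. A connected graph that covers a component of `G` has at most as many vertices as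
that component has finite walks, so graphs in the universe of `G` are all that is needed here. -/
structure IsLocalCovering {W V : Type u} {H : SimpleGraph W} {G : SimpleGraph V}
    (r : ℕ) (p : H →g G) : Prop where
  isCovering : IsCovering p
  isBallPreserving : IsBallPreserving r p
  universal : ∀ (W' : Type u) (H' : SimpleGraph W') (p' : H' →g G),
    IsCovering p' → IsBallPreserving r p' → ∃ q : H →g H', IsCovering q ∧ p = p'.comp q

/-- The edge boundary of `X`: the edges with precisely one endvertex in `X`. -/
def edgeCut {V : Type u} (G : SimpleGraph V) (X : Set V) : Set (Sym2 V) :=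
  {e | ∃ a b : V, e = s(a, b) ∧ G.Adj a b ∧ a ∈ X ∧ b ∉ X}

/-- An `X`-walk: its first and last vertices are in `X`, and it otherwise avoids `X`. -/
def Walk.IsSetWalk {V : Type u} {G : SimpleGraph V} (X : Set V) {a b : V} (w : G.Walk a b) :
    Prop :=
  a ∈ X ∧ b ∈ X ∧ ∀ i : ℕ, 0 < i → i < w.length → w.getVert i ∉ X

/-- A walk is `r`-local if it is a walk in a cycle of length at most `r`, or traverses a single
edge. -/
def Walk.IsShortLocal {V : Type u} {G : SimpleGraph V} (r : ℕ) {a b : V} (w : G.Walk a b) :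
    Prop :=
  (∃ (z : V) (c : G.Walk z z), c.IsCycle ∧ c.length ≤ r ∧ w.toSubgraph ≤ c.toSubgraph) ∨
    w.length = 1

/-- The relation `∼ᵣ` at `X` on the edge boundary of `X`: two edges are related if they are equal
or the first and the last edge on an `r`-local `X`-walk. -/
def LocalRel {V : Type u} (G : SimpleGraph V) (r : ℕ) (X : Set V) (e f : Sym2 V) : Prop :=
  e ∈ G.edgeCut X ∧ f ∈ G.edgeCut X ∧
    (e = f ∨ ∃ (a b : V) (w : G.Walk a b), w.IsSetWalk X ∧ w.IsShortLocal r ∧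
      w.edges.head? = some e ∧ w.edges.getLast? = some f)

/-- The `r`-local component at `X` that contains the edge `e` of the boundary of `X`: the class
of `e` under the transitive closure of `∼ᵣ`. -/
def localComponent {V : Type u} (G : SimpleGraph V) (r : ℕ) (X : Set V) (e : Sym2 V) :
    Set (Sym2 V) :=
  {f | Relation.TransGen (G.LocalRel r X) e f}

/-- For two vertices `x`, `y` with common neighbour `z`: the set `X` is an `r`-local `x`–`y`
separator with respect to `z` if it avoids `x` and `y`, contains `z`, and the edges `xz` and `zy`
are in distinct `r`-local components at `X`. -/
def IsLocalSeparatorOf {V : Type u} (G : SimpleGraph V) (r : ℕ) (x z y : V) (X : Set V) : Prop :=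
  x ∉ X ∧ y ∉ X ∧ z ∈ X ∧ G.localComponent r X s(x, z) ≠ G.localComponent r X s(z, y)

/-- A minimal `r`-local separator: an inclusion-minimal `r`-local `x`–`y` separator with respect
to `z`, for some vertices `x`, `y` of distance two and some common neighbour `z` of them. -/
def IsMinimalLocalSeparator {V : Type u} (G : SimpleGraph V) (r : ℕ) (X : Set V) : Prop :=
  ∃ x z y : V, G.dist x y = 2 ∧ G.Adj x z ∧ G.Adj z y ∧
    Minimal (fun Y : Set V => G.IsLocalSeparatorOf r x z y Y) X

end SimpleGraph

/-! The implications proved are 1 → 2 → 3 → 1 and 2 ↔ 4. The tool for the two hard ones, 2 → 3 and 2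
→ 4, is a `ZMod 2`-labelling of edges that sums to zero over triangles (`IsCocycle`). In an
`r`-chordal graph chords cut closed walks of length at most `r` down to triangles, so a cocycle sums
to zero over them (`IsLengthChordal.labelSum_eq_zero`). Wheel-freeness makes all neighbourhoods
chordal.

The `r`-local cover consists of the `r`-homotopy classes of walks from base points. A local
bijection is ball-preserving exactly if it satisfies `ClosesShortWalks`, and then `r`-homotopies
lift. Hence this cover is universal, and closed walks in any `r`-local cover are `r`-homotopic to
constant ones.

2 → 3: both properties lift to the cover. If the cover had a chordless cycle, labelling one of its
edges 1 and all others 0 would be a cocycle on the vertices of the cycle. It extends to any finite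
set of further vertices, because on the chordal neighbourhood of a new vertex it is a coboundary.
Null-homotopy forces the sum over the cycle to be 0, but it is 1.

3 → 1: balls of a chordal graph are chordal (`IsChordal.isLocallyChordal`), and balls of the cover
are balls of `G`. 1 → 2: a short cycle lies in the ball around each of its vertices, a wheel in the
ball around its hub.

2 → 4: a local separator `X` with respect to `z` separates `x` from `y` in the chordal neighbourhood
of `z`, so it contains a clique that does so. That clique together with `z` is a local separator, as
a suitable cocycle shows (`IsClique.isLocalSeparatorOf`), and by minimality it contains `X`. 4 → 2:
a chordless short cycle, or the rim of a wheel, forces two nonadjacent vertices into a minimal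
separator, or one of the two vertices to be separated. -/

namespace SimpleGraph

/-! ### Walks, edge labellings and cocycles -/

section Walks

variable {V : Type u} {G : SimpleGraph V}

/-- The subgraph induced on `S`, as a graph on the whole vertex type. -/
def restrictTo (G : SimpleGraph V) (S : Set V) : SimpleGraph V where
  Adj a b := G.Adj a b ∧ a ∈ S ∧ b ∈ S
  symm := ⟨fun _ _ h => ⟨h.1.symm, h.2.2, h.2.1⟩⟩
  loopless := ⟨fun _ h => h.1.ne rfl⟩

theorem restrictTo_adj {S : Set V} {a b : V} :
    (G.restrictTo S).Adj a b ↔ G.Adj a b ∧ a ∈ S ∧ b ∈ S := Iff.rfl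

theorem restrictTo_le (G : SimpleGraph V) (S : Set V) : G.restrictTo S ≤ G := fun _ _ h => h.1

theorem restrictTo_mono {S T : Set V} (h : S ⊆ T) : G.restrictTo S ≤ G.restrictTo T :=
  fun _ _ hab => ⟨hab.1, h hab.2.1, h hab.2.2⟩

theorem Walk.support_subset_of_restrictTo {S : Set V} {a b : V} (w : (G.restrictTo S).Walk a b)
    (ha : a ∈ S) : ∀ t ∈ w.support, t ∈ S := by
  induction w with
  | nil => simpa using ha
  | cons h p ih =>
    intro t ht
    rw [Walk.support_cons, List.mem_cons] at ht
    rcases ht with rfl | ht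
    · exact ha
    · exact ih h.2.2 t ht

theorem Walk.reachable_restrictTo {S : Set V} {a b : V} (w : G.Walk a b)
    (hw : ∀ t ∈ w.support, t ∈ S) : (G.restrictTo S).Reachable a b := by
  induction w with
  | nil => rfl
  | @cons x y z h p ih =>
    refine Reachable.trans (Adj.reachable ⟨h, hw _ (by simp), hw _ (by simp)⟩)
      (ih fun t ht => hw t (by simp [ht]))

/-- A property that is preserved along edges is preserved along walks. -/
theorem Reachable.induct {P : V → Prop} (hP : ∀ a b, G.Adj a b → P a → P b) {a b : V}
    (h : G.Reachable a b) (ha : P a) : P b := by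
  obtain ⟨w⟩ := h
  induction w with
  | nil => exact ha
  | cons h p ih => exact ih (hP _ _ h ha)

/-- Reachability inside `S`, from a vertex whose component in `G.restrictTo S` lies in `T`. -/
theorem Reachable.restrictTo_of_closed {S T : Set V}
    (hT : ∀ a b, (G.restrictTo S).Adj a b → a ∈ T → b ∈ T) {a b : V}
    (h : (G.restrictTo S).Reachable a b) (ha : a ∈ T) : (G.restrictTo T).Reachable a b := by
  obtain ⟨w⟩ := h
  induction w with
  | nil => rfl
  | cons h p ih =>
    exact Reachable.trans (Adj.reachable ⟨h.1, ha, hT _ _ h ha⟩) (ih (hT _ _ h ha))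

theorem Walk.exists_eq_append {a b u : V} (w : G.Walk a b) {i : ℕ} (hi : i ≤ w.length)
    (hu : w.getVert i = u) :
    ∃ (p : G.Walk a u) (q : G.Walk u b), w = p.append q ∧ p.length = i ∧
      q.length = w.length - i := by
  subst hu
  exact ⟨w.take i, w.drop i, (w.append_take_drop_eq i).symm, by simp [hi], by simp⟩

theorem Walk.exists_eq_append_append {a b u v : V} (w : G.Walk a b) {i j : ℕ} (hij : i ≤ j)
    (hj : j ≤ w.length) (hu : w.getVert i = u) (hv : w.getVert j = v) :
    ∃ (p : G.Walk a u) (q : G.Walk u v) (s : G.Walk v b), w = p.append (q.append s) ∧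
      p.length = i ∧ q.length = j - i ∧ s.length = w.length - j := by
  subst hu
  obtain ⟨q, s, hqs, hq, hs⟩ := (w.drop i).exists_eq_append (i := j - i) (u := v)
    (by simp; omega) (by rw [Walk.drop_getVert, Nat.add_sub_cancel' hij, hv])
  refine ⟨w.take i, q, s, ?_, by simp; omega, hq, by rw [hs]; simp; omega⟩
  rw [← hqs, w.append_take_drop_eq i]

theorem Walk.mk_getVert_mem_edges {a b : V} (w : G.Walk a b) {i : ℕ} (hi : i < w.length) :
    s(w.getVert i, w.getVert (i + 1)) ∈ w.edges :=
  (w.mk_mem_edges_iff_exists).2 ⟨i, hi, rfl⟩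

/-- The sum of a `ZMod 2`-valued edge labelling along a walk. -/
def Walk.labelSum (φ : Sym2 V → ZMod 2) {a b : V} (w : G.Walk a b) : ZMod 2 :=
  (w.edges.map φ).sum

@[simp] theorem Walk.labelSum_nil (φ : Sym2 V → ZMod 2) (a : V) :
    (Walk.nil : G.Walk a a).labelSum φ = 0 := by simp [Walk.labelSum]

@[simp] theorem Walk.labelSum_cons (φ : Sym2 V → ZMod 2) {a b c : V} (h : G.Adj a b)
    (w : G.Walk b c) : (Walk.cons h w).labelSum φ = φ s(a, b) + w.labelSum φ := by
  simp [Walk.labelSum]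

@[simp] theorem Walk.labelSum_append (φ : Sym2 V → ZMod 2) {a b c : V} (w : G.Walk a b)
    (w' : G.Walk b c) : (w.append w').labelSum φ = w.labelSum φ + w'.labelSum φ := by
  simp [Walk.labelSum]

@[simp] theorem Walk.labelSum_reverse (φ : Sym2 V → ZMod 2) {a b : V} (w : G.Walk a b) :
    w.reverse.labelSum φ = w.labelSum φ := by
  simp [Walk.labelSum, List.sum_reverse]

theorem zmodTwo_add_self (x : ZMod 2) : x + x = 0 := by
  revert x; decide

theorem zmodTwo_eq_of_add {x y : ZMod 2} (h : x + y = 0) : x = y := by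
  revert x y; decide

/-- A labelling is a cocycle if its sum over every triangle is zero. -/
def IsCocycle (G : SimpleGraph V) (φ : Sym2 V → ZMod 2) : Prop :=
  ∀ a b c, G.Adj a b → G.Adj b c → G.Adj a c → φ s(a, b) + φ s(b, c) + φ s(a, c) = 0

/-- A repeated vertex or a chord splits a closed walk into two shorter ones. The chord is counted
twice, so it cancels modulo 2, and induction on the length leaves closed walks of length at most 3.
-/
theorem IsLengthChordal.labelSum_eq_zero {r : ℕ} (hG : G.IsLengthChordal r)
    {φ : Sym2 V → ZMod 2} (hφ : G.IsCocycle φ) {z : V} (c : G.Walk z z) (hc : c.length ≤ r) :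
    c.labelSum φ = 0 := by
  induction hn : c.length using Nat.strong_induction_on generalizing z c with
  | _ n ih =>
  subst hn
  -- The bounds `2 ≤ j - i` and `j - i + 1 < c.length` say that both closed walks through the chord
  -- are shorter than `c`.
  have key : ∀ i j, i < j → j ≤ c.length → j - i < c.length →
      (c.getVert i = c.getVert j ∨ (G.Adj (c.getVert i) (c.getVert j) ∧ 2 ≤ j - i ∧
        j - i + 1 < c.length)) → c.labelSum φ = 0 := by
    intro i j hij hj hji h
    obtain ⟨p, q, s, he, hp, hq, hs⟩ := c.exists_eq_append_append hij.le hj rfl rfl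
    rcases h with h | ⟨h, h2, h3⟩
    · have e1 := ih ((q.copy h rfl).length) (by simp; omega) (q.copy h rfl)
        (by simp; omega) rfl
      have e2 := ih ((p.append (s.copy h.symm rfl)).length) (by simp; omega)
        (p.append (s.copy h.symm rfl)) (by simp; omega) rfl
      rw [he]
      have f1 : (q.copy h rfl).labelSum φ = q.labelSum φ := by simp [Walk.labelSum]
      have f2 : (s.copy h.symm rfl).labelSum φ = s.labelSum φ := by simp [Walk.labelSum]
      simp only [Walk.labelSum_append, f1, f2] at e1 e2 ⊢
      rw [e1, zero_add, e2]
    · have e1 := ih ((Walk.cons h.symm q).length) (by simp; omega) (Walk.cons h.symm q)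
        (by simp; omega) rfl
      have e2 := ih ((p.append (Walk.cons h s)).length) (by simp; omega)
        (p.append (Walk.cons h s)) (by simp; omega) rfl
      rw [he]
      simp only [Walk.labelSum_append, Walk.labelSum_cons] at e1 e2 ⊢
      rw [Sym2.eq_swap] at e1
      rw [← zmodTwo_eq_of_add e1, e2]
  rcases Nat.lt_or_ge c.length 4 with h4 | h4
  · match c, h4 with
    | .nil, _ => simp
    | .cons h .nil, _ => exact absurd h (G.loopless.irrefl _)
    | .cons h (.cons h' .nil), _ =>
      simp [Sym2.eq_swap, zmodTwo_add_self]
    | .cons h (.cons h' (.cons h'' .nil)), _ =>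
      have := hφ _ _ _ h h' h''.symm
      rw [Sym2.eq_swap (a := z)] at this
      simpa [add_assoc, Sym2.eq_swap] using this
    | .cons _ (.cons _ (.cons _ (.cons _ _))), h => simp at h; omega
  by_cases hcyc : c.IsCycle
  · obtain ⟨a, ha, b, hb, hab, hnot⟩ := hG z c hcyc h4 hc
    obtain ⟨i, hi, hil⟩ := Walk.mem_support_iff_exists_getVert.mp ha
    obtain ⟨j, hj, hjl⟩ := Walk.mem_support_iff_exists_getVert.mp hb
    have hedge : ∀ i j, i ≤ c.length → j ≤ c.length → i < j →
        G.Adj (c.getVert i) (c.getVert j) → s(c.getVert i, c.getVert j) ∉ c.edges →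
        c.labelSum φ = 0 := by
      intro i j hi hj hij hadj hnot
      have h1 : j ≠ i + 1 := by
        rintro rfl
        exact hnot (c.mk_getVert_mem_edges (by omega))
      have h2 : ¬ (i = 0 ∧ j = c.length) := by
        rintro ⟨rfl, rfl⟩
        simp at hadj
      have h3 : ¬ (j - i + 1 = c.length) := by
        intro h
        have : (i = 0 ∧ j + 1 = c.length) ∨ (i = 1 ∧ j = c.length) := by omega
        rcases this with ⟨rfl, hj'⟩ | ⟨rfl, rfl⟩
        · apply hnot
          have := c.mk_getVert_mem_edges (i := j) (by omega)
          rw [hj', Walk.getVert_length, Sym2.eq_swap] at this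
          simpa using this
        · apply hnot
          have := c.mk_getVert_mem_edges (i := 0) (by omega)
          rw [Sym2.eq_swap] at this
          simpa using this
      exact key i j hij hj (by omega) (Or.inr ⟨hadj, by omega, by omega⟩)
    subst hi hj
    rcases lt_trichotomy i j with h | rfl | h
    · exact hedge i j hil hjl h hab hnot
    · exact absurd hab (G.loopless.irrefl _)
    · exact hedge j i hjl hil h hab.symm (by rwa [Sym2.eq_swap])
  -- A closed walk of length at least 3 that is no cycle repeats a vertex on its tail; positions on
  -- the tail are shifted by one.
  · rw [Walk.isCycle_iff_isPath_tail_and_le_length, not_and'] at hcyc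
    have hp := hcyc (by omega)
    rw [← Walk.IsPath.getVert_injOn_iff] at hp
    simp only [Set.InjOn, not_forall] at hp
    obtain ⟨i, hi, j, hj, he, hne⟩ := hp
    simp only [Set.mem_ofPred_eq, Walk.getVert_tail] at hi hj he
    have hl : c.tail.length = c.length - 1 := by simp
    rw [hl] at hi hj
    rcases lt_or_gt_of_ne hne with h | h
    · exact key (i + 1) (j + 1) (by omega) (by omega) (by omega) (Or.inl he)
    · exact key (j + 1) (i + 1) (by omega) (by omega) (by omega) (Or.inl he.symm)

end Walks

/-! ### Chordal graphs and their clique separators -/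

section Chordal

variable {V : Type u} {G : SimpleGraph V}

theorem IsLengthChordal.restrictTo {r : ℕ} (hG : G.IsLengthChordal r) (S : Set V) :
    (G.restrictTo S).IsLengthChordal r := by
  intro z c hc h4 hr
  obtain ⟨a, ha, b, hb, hab, hnot⟩ := hG z (c.mapLe (G.restrictTo_le S))
    (hc.mapLe _) (by simpa using h4) (by simpa using hr)
  simp only [Walk.support_mapLe_eq_support, Walk.edges_mapLe_eq_edges] at ha hb hnot
  have hz : z ∈ S := by
    cases c with
    | nil => exact absurd h4 (by simp)
    | cons h p => exact h.2.1
  exact ⟨a, ha, b, hb, ⟨hab, c.support_subset_of_restrictTo hz a ha,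
    c.support_subset_of_restrictTo hz b hb⟩, hnot⟩

theorem isChordal_iff_isLengthChordal : G.IsChordal ↔ ∀ r, G.IsLengthChordal r :=
  ⟨fun h _ z c hc h4 _ => h z c hc h4, fun h z c hc h4 => h c.length z c hc h4 le_rfl⟩

theorem IsChordal.restrictTo (hG : G.IsChordal) (S : Set V) : (G.restrictTo S).IsChordal :=
  isChordal_iff_isLengthChordal.2 fun r => (isChordal_iff_isLengthChordal.1 hG r).restrictTo S

theorem Walk.exists_shorter_of_adj {a b : V} (w : G.Walk a b) {i j : ℕ} (hij : i + 1 < j)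
    (hj : j ≤ w.length) (h : G.Adj (w.getVert i) (w.getVert j)) :
    ∃ w' : G.Walk a b, w'.length < w.length ∧ w'.support ⊆ w.support := by
  obtain ⟨p, q, s, he, hp, hq, hs⟩ := w.exists_eq_append_append (i := i) (by omega) hj rfl rfl
  refine ⟨p.append (Walk.cons h s), by simp; omega, ?_⟩
  have hsup : ∀ t, t ∈ w.support ↔ t ∈ p.support ∨ t ∈ q.support ∨ t ∈ s.support := fun t => by
    conv_lhs => rw [he]
    simp only [Walk.mem_support_append_iff]
  intro t
  simp only [hsup, Walk.mem_support_append_iff, Walk.support_cons, List.mem_cons]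
  rintro (h | rfl | h)
  · exact Or.inl h
  · exact Or.inl (by simp)
  · exact Or.inr (Or.inr h)

/-- The edge between the two neighbours of the base of a cycle is not in the cycle, unless the
cycle is a triangle. -/
theorem Walk.IsCycle.snd_penultimate_notMem_edges {z : V} {c : G.Walk z z} (hc : c.IsCycle)
    (h4 : 4 ≤ c.length) : s(c.snd, c.penultimate) ∉ c.edges := by
  rw [Walk.mk_mem_edges_iff_exists]
  rintro ⟨i, hi, h⟩
  have inj : ∀ i j, i < c.length → j < c.length → c.getVert i = c.getVert j → i = j :=
    fun i j hi hj h => hc.getVert_injOn' (by simp; omega) (by simp; omega) h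
  have hs : ∀ j, j ≤ c.length → c.getVert j = c.snd → j = 1 := by
    intro j hj h
    rcases Nat.lt_or_ge j c.length with hj' | hj'
    · exact inj j 1 hj' (by omega) h
    · have : j = c.length := by omega
      subst this
      have := inj 0 1 (by omega) (by omega) (by simpa using h)
      omega
  have hp : ∀ j, j ≤ c.length → c.getVert j = c.penultimate → j = c.length - 1 := by
    intro j hj h
    rcases Nat.lt_or_ge j c.length with hj' | hj'
    · exact inj j _ hj' (by omega) h
    · have : j = c.length := by omega
      subst this
      have := inj 0 (c.length - 1) (by omega) (by omega) (by simpa using h)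
      omega
  rw [Sym2.eq_iff] at h
  rcases h with ⟨h1, h2⟩ | ⟨h1, h2⟩
  · have := hs _ hi.le h1
    have := hp _ (by omega) h2
    omega
  · have := hp _ hi.le h1
    have := hs _ (by omega) h2
    omega

/-- In a chordal graph, the ends of a walk are adjacent if they are the only neighbours on it
of a vertex outside it. -/
theorem IsChordal.adj_of_walk (hG : G.IsChordal) {v a b : V} (hva : G.Adj v a) (hvb : G.Adj v b)
    (hab : a ≠ b) (w : G.Walk a b) (hv : v ∉ w.support)
    (hw : ∀ t ∈ w.support, G.Adj v t → t = a ∨ t = b) : G.Adj a b := by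
  classical
  induction hn : w.length using Nat.strong_induction_on generalizing w with
  | _ n ih =>
  subst hn
  have shorter : ∀ w' : G.Walk a b, w'.length < w.length → w'.support ⊆ w.support →
      G.Adj a b := fun w' hl hs =>
    ih _ hl w' (fun h => hv (hs h)) (fun t ht => hw t (hs ht)) rfl
  by_cases hp : w.IsPath
  swap
  · refine shorter w.bypass ?_ w.support_bypass_subset_support
    by_contra hlt
    exact hp (w.bypass_eq_self_of_length_le_length_bypass (not_lt.1 hlt) ▸ w.bypass_isPath)
  rcases Nat.lt_or_ge w.length 2 with h2 | h2
  · match w, h2 with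
    | .nil, _ => exact absurd rfl hab
    | .cons h .nil, _ => exact h
    | .cons _ (.cons _ _), h => simp at h
  -- With `v` added the path becomes a cycle. No chord of it ends in `v`, whose only neighbours on
  -- `w` are `a` and `b`, so a chord shortens `w`.
  have hcyc : (Walk.cons hva (w.concat hvb.symm)).IsCycle := by
    rw [Walk.isCycle_iff_isPath_tail_and_le_length]
    refine ⟨?_, by simp; omega⟩
    simpa using (Walk.concat_isPath_iff _).2 ⟨hp, hv⟩
  obtain ⟨s, hs, t, ht, hst, hnot⟩ := hG v _ hcyc (by simp; omega)
  have hno : ∀ t, G.Adj v t → t ∈ w.support → s(v, t) ∉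
      (Walk.cons hva (w.concat hvb.symm)).edges → False := by
    intro t h1 h2 h3
    apply h3
    rcases hw t h2 h1 with rfl | rfl
    · simp
    · simp [Walk.edges_concat, Sym2.eq_swap]
  have hmem : ∀ t, t ∈ (Walk.cons hva (w.concat hvb.symm)).support → t = v ∨ t ∈ w.support := by
    intro t
    simp only [Walk.support_cons, Walk.support_concat, List.mem_cons, List.mem_append,
      List.not_mem_nil]
    tauto
  rcases hmem s hs with rfl | hs'
  · rcases hmem t ht with rfl | ht'
    · exact absurd hst (G.loopless.irrefl _)
    · exact (hno t hst ht' hnot).elim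
  rcases hmem t ht with rfl | ht'
  · exact (hno s hst.symm hs' (by rwa [Sym2.eq_swap])).elim
  obtain ⟨i, rfl, hil⟩ := Walk.mem_support_iff_exists_getVert.mp hs'
  obtain ⟨j, rfl, hjl⟩ := Walk.mem_support_iff_exists_getVert.mp ht'
  have hnot' : s(w.getVert i, w.getVert j) ∉ w.edges := fun h => hnot (by
    simp [Walk.edges_concat, h])
  have main : ∀ i j, i < j → j ≤ w.length → G.Adj (w.getVert i) (w.getVert j) →
      s(w.getVert i, w.getVert j) ∉ w.edges → G.Adj a b := by
    intro i j hij hj hadj hn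
    have : j ≠ i + 1 := by
      rintro rfl
      exact hn (w.mk_getVert_mem_edges (by omega))
    obtain ⟨w', h1, h2⟩ := w.exists_shorter_of_adj (by omega) hj hadj
    exact shorter w' h1 h2
  rcases lt_trichotomy i j with h | rfl | h
  · exact main i j h hjl hst hnot'
  · exact absurd hst (G.loopless.irrefl _)
  · exact main j i h hil hst.symm (by rwa [Sym2.eq_swap])

/-- In a chordal graph, neighbours of `v` that are connected in a set avoiding `v` are connected
by neighbours of `v` in that set. -/
theorem IsChordal.reachable_inter_neighborSet (hG : G.IsChordal) {S : Set V} {v c d : V}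
    (hvS : v ∉ S) (hcS : c ∈ S) (hvc : G.Adj v c) (hvd : G.Adj v d)
    (h : (G.restrictTo S).Reachable c d) :
    (G.restrictTo (S ∩ G.neighborSet v)).Reachable c d := by
  obtain ⟨w⟩ := h
  -- Here `p` stops at its first neighbour `d'` of `v`. When the walk is extended backwards to a
  -- neighbour `x` of `v`, `adj_of_walk` makes `x` and `d'` equal or adjacent.
  have key : ∀ {c : V} (w : (G.restrictTo S).Walk c d), c ∈ S → ∃ (d' : V)
      (p : (G.restrictTo S).Walk c d'), G.Adj v d' ∧
      (G.restrictTo (S ∩ G.neighborSet v)).Reachable d' d ∧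
      ∀ t ∈ p.support, G.Adj v t → t = d' := by
    intro c w hc
    clear hvc hcS
    induction w with
    | nil => exact ⟨_, .nil, hvd, Reachable.refl _, by simp⟩
    | @cons x y z hxy q ih =>
      obtain ⟨d', p, h1, h2, h3⟩ := ih hvd ‹_› hxy.2.2
      by_cases hx : G.Adj v x
      · refine ⟨x, .nil, hx, ?_, by simp⟩
        by_cases hxd : x = d'
        · exact hxd ▸ h2
        refine Reachable.trans (Adj.reachable ⟨?_, ⟨hc, hx⟩, ?_, h1⟩) h2
        · have hsup := (Walk.cons hxy p).support_subset_of_restrictTo hc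
          refine hG.adj_of_walk hx h1 hxd ((Walk.cons hxy p).mapLe (G.restrictTo_le S)) ?_ ?_
          · rw [Walk.support_mapLe_eq_support]
            exact fun h => hvS (hsup _ h)
          · intro t ht hvt
            rw [Walk.support_mapLe_eq_support, Walk.support_cons, List.mem_cons] at ht
            rcases ht with rfl | ht
            · exact Or.inl rfl
            · exact Or.inr (h3 t ht hvt)
        · exact p.support_subset_of_restrictTo hxy.2.2 _ (by simp)
      · refine ⟨d', .cons hxy p, h1, h2, ?_⟩
        intro t ht hvt
        rw [Walk.support_cons, List.mem_cons] at ht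
        rcases ht with rfl | ht
        · exact absurd hvt hx
        · exact h3 t ht hvt
  obtain ⟨d', p, -, h2, h3⟩ := key w hcS
  exact h3 c (by simp) hvc ▸ h2

/-- A set that separates two vertices of a chordal graph contains a clique that does so. -/
theorem IsChordal.exists_isClique_separator (hG : G.IsChordal) {S : Set V} {x y : V}
    (hx : x ∉ S) (hy : y ∉ S) (hsep : ¬ (G.restrictTo Sᶜ).Reachable x y) :
    ∃ Y ⊆ S, G.IsClique Y ∧ (∀ s ∈ Y, ∃ t, G.Adj s t) ∧
      ¬ (G.restrictTo Yᶜ).Reachable x y := by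
  -- `S` is thinned out twice: to the vertices with a neighbour in the component `Dx` of `x`, then
  -- to those that also have one in the component `Dy` of `y` after the first thinning.
  set Dx : Set V := {t | (G.restrictTo Sᶜ).Reachable x t} with hDx
  have hDxS : ∀ t ∈ Dx, t ∉ S := fun t ht =>
    Reachable.induct (G := G.restrictTo Sᶜ) (P := fun t => t ∉ S) (fun a b h _ => h.2.2) ht hx
  set S1 : Set V := {s | s ∈ S ∧ ∃ t ∈ Dx, G.Adj s t} with hS1
  have hDxcl : ∀ a b, G.Adj a b → b ∉ S1 → a ∈ Dx → b ∈ Dx := by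
    intro a b hab hb ha
    have hbS : b ∉ S := fun h => hb ⟨h, a, ha, hab.symm⟩
    exact Reachable.trans ha (Adj.reachable ⟨hab, hDxS a ha, hbS⟩)
  set Dy : Set V := {t | (G.restrictTo S1ᶜ).Reachable y t} with hDy
  have hy1 : y ∉ S1 := fun h => hy h.1
  have hDyS : ∀ t ∈ Dy, t ∉ S1 := fun t ht =>
    Reachable.induct (G := G.restrictTo S1ᶜ) (P := fun t => t ∉ S1) (fun a b h _ => h.2.2) ht hy1
  have hdisj : ∀ t ∈ Dx, t ∉ Dy := by
    intro t htx hty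
    have : y ∈ Dx := Reachable.induct (G := G.restrictTo S1ᶜ) (P := fun t => t ∈ Dx)
      (fun a b h ha => hDxcl a b h.1 h.2.2 ha) (Reachable.symm hty) htx
    exact hsep this
  set S2 : Set V := {s | s ∈ S1 ∧ ∃ t ∈ Dy, G.Adj s t} with hS2
  refine ⟨S2, fun s hs => hs.1.1, ?_, fun s hs => ?_, ?_⟩
  · intro s hs t ht hne
    by_contra hst
    obtain ⟨s1, hs1, hss1⟩ := hs.1.2
    obtain ⟨t1, ht1, htt1⟩ := ht.1.2
    obtain ⟨s2, hs2, hss2⟩ := hs.2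
    obtain ⟨t2, ht2, htt2⟩ := ht.2
    set T : Set V := Dx ∪ Dy ∪ {t} with hT
    have hsT : s ∉ T := by
      rintro ((h | h) | h)
      · exact hDxS s h hs.1.1
      · exact hDyS s h hs.1
      · exact hne h
    have r1 : (G.restrictTo Dx).Reachable s1 t1 := by
      have : (G.restrictTo Sᶜ).Reachable s1 t1 := (Reachable.symm hs1).trans ht1
      exact this.restrictTo_of_closed (fun a b h ha => Reachable.trans ha h.reachable) hs1
    have r2 : (G.restrictTo Dy).Reachable t2 s2 := by
      have : (G.restrictTo S1ᶜ).Reachable t2 s2 := (Reachable.symm ht2).trans hs2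
      exact this.restrictTo_of_closed (fun a b h ha => Reachable.trans ha h.reachable) ht2
    have htT : t ∈ T := Or.inr rfl
    have r : (G.restrictTo T).Reachable s1 s2 := by
      refine (r1.mono (restrictTo_mono fun a h => Or.inl (Or.inl h))).trans ?_
      refine Reachable.trans ?_ (r2.mono (restrictTo_mono fun a h => Or.inl (Or.inr h)))
      exact (Adj.reachable (G := G.restrictTo T) (v := t) ⟨htt1.symm, Or.inl (Or.inl ht1), htT⟩).trans
        (Adj.reachable ⟨htt2, htT, Or.inl (Or.inr ht2)⟩)
    -- Inside `T` the two sides are joined only through `t`. Since `t` is no neighbour of `s`, a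
    -- walk through neighbours of `s` can never leave `Dx`.
    have r' := hG.reachable_inter_neighborSet hsT (Or.inl (Or.inl hs1)) hss1 hss2 r
    have : s2 ∈ Dx := by
      refine Reachable.induct (P := fun t => t ∈ Dx) (fun a b h ha => ?_) r' hs1
      rcases h.2.2 with ⟨(hb | hb) | rfl, hsb⟩
      · exact hb
      · exact hDxcl a b h.1 (hDyS b hb) ha
      · exact absurd hsb hst
    exact hdisj s2 this hs2
  · obtain ⟨t, -, h⟩ := hs.2
    exact ⟨t, h⟩
  · intro h
    have : x ∈ Dy := by
      refine Reachable.induct (P := fun t => t ∈ Dy) (fun a b h ha => ?_) h.symm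
        (Reachable.refl (G := G.restrictTo S1ᶜ) y)
      have hb : b ∉ S1 := fun hb => h.2.2 ⟨hb, a, ha, h.1.symm⟩
      exact Reachable.trans ha (Adj.reachable ⟨h.1, hDyS a ha, hb⟩)
    exact hdisj x (Reachable.refl _) this

end Chordal

/-! ### Extending cocycles; chordality from null-homotopic closed walks -/

section Cocycles

variable {V : Type u} {G : SimpleGraph V}

/-- The elementary homotopies of order `r`: deleting a closed walk of length at most `r`. -/
def Walk.ShortStep (r : ℕ) {a b : V} (w w' : G.Walk a b) : Prop :=
  ∃ (m : V) (p : G.Walk a m) (l : G.Walk m m) (q : G.Walk m b), l.length ≤ r ∧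
    w = p.append (l.append q) ∧ w' = p.append q

/-- Two walks are `r`-homotopic if they differ by inserting and deleting closed walks of length
at most `r`. -/
def Walk.ShortHomotopic (r : ℕ) {a b : V} (w w' : G.Walk a b) : Prop :=
  Relation.EqvGen (Walk.ShortStep r) w w'

theorem restrictTo_restrictTo (S T : Set V) :
    (G.restrictTo S).restrictTo T = G.restrictTo (S ∩ T) := by
  ext a b
  simp only [restrictTo_adj, Set.mem_inter_iff]
  tauto

theorem IsCocycle.anti {G' : SimpleGraph V} (h : G' ≤ G) {φ : Sym2 V → ZMod 2}
    (hφ : G.IsCocycle φ) : G'.IsCocycle φ :=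
  fun a b c h1 h2 h3 => hφ a b c (h h1) (h h2) (h h3)

/-- A homotopy deletes and inserts finitely many closed walks, and `F` collects their vertices.
Finiteness matters because cocycles are extended one vertex at a time. -/
theorem Walk.ShortHomotopic.labelSum_eq {r : ℕ} (hG : G.IsLengthChordal r) {a b : V}
    {w w' : G.Walk a b} (h : w.ShortHomotopic r w') :
    ∃ F : Finset V, ∀ φ : Sym2 V → ZMod 2, (G.restrictTo F).IsCocycle φ →
      w.labelSum φ = w'.labelSum φ := by
  classical
  induction h with
  | rel w w' h =>
    obtain ⟨m, p, l, q, hl, rfl, rfl⟩ := h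
    refine ⟨l.support.toFinset, fun φ hφ => ?_⟩
    have hl' : ∀ e ∈ l.edges, e ∈ (G.restrictTo (l.support.toFinset : Set V)).edgeSet := by
      intro e
      induction e with
      | _ x y =>
        intro he
        exact ⟨l.adj_of_mem_edges he, by simpa using l.fst_mem_support_of_mem_edges he,
          by simpa using l.snd_mem_support_of_mem_edges he⟩
    have := (hG.restrictTo _).labelSum_eq_zero hφ (l.transfer _ hl') (by simpa using hl)
    rw [Walk.labelSum, Walk.edges_transfer] at this
    simp [Walk.labelSum] at this ⊢
    exact this
  | refl w => exact ⟨∅, fun _ _ => rfl⟩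
  | symm w w' _ ih => exact ih.imp fun F h φ hφ => (h φ hφ).symm
  | trans w w' w'' _ _ ih ih' =>
    obtain ⟨F, hF⟩ := ih
    obtain ⟨F', hF'⟩ := ih'
    refine ⟨F ∪ F', fun φ hφ => (hF φ (hφ.anti (restrictTo_mono ?_))).trans
      (hF' φ (hφ.anti (restrictTo_mono ?_)))⟩ <;> simp

/-- The potential at a vertex is the sum along a chosen walk from a base point of its component; it
does not depend on the choice, as closed walks sum to zero. -/
theorem exists_potential {φ : Sym2 V → ZMod 2}
    (h : ∀ (z : V) (c : G.Walk z z), c.labelSum φ = 0) :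
    ∃ ψ : V → ZMod 2, ∀ a b, G.Adj a b → φ s(a, b) = ψ a + ψ b := by
  have hw : ∀ a : V, Nonempty (G.Walk (G.connectedComponentMk a).out a) := fun a =>
    ConnectedComponent.exact (Quot.out_eq (G.connectedComponentMk a))
  have key : ∀ {s s' a b : V} (_ : s = s') (w : G.Walk s a) (w' : G.Walk s' b) (hab : G.Adj a b),
      φ s(a, b) = w.labelSum φ + w'.labelSum φ := by
    rintro s _ a b rfl w w' hab
    have := h _ (w.append (Walk.cons hab w'.reverse))
    rw [Walk.labelSum_append, Walk.labelSum_cons, Walk.labelSum_reverse, add_left_comm] at this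
    exact zmodTwo_eq_of_add this
  refine ⟨fun a => (hw a).some.labelSum φ, fun a b hab => key ?_ _ _ hab⟩
  rw [ConnectedComponent.eq.2 hab.reachable]

/-- On the chordal graph induced by the neighbours of `v` in `F`, the cocycle has a potential `ψ`.
Labelling `va` by `ψ a` makes all triangles at `v` sum to zero. -/
theorem exists_extension_cocycle {F : Set V} {v : V} (hv : v ∉ F)
    (hch : (G.restrictTo (G.neighborSet v)).IsChordal) {φ : Sym2 V → ZMod 2}
    (hφ : (G.restrictTo F).IsCocycle φ) :
    ∃ φ' : Sym2 V → ZMod 2, (G.restrictTo (insert v F)).IsCocycle φ' ∧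
      ∀ a ∈ F, ∀ b ∈ F, φ' s(a, b) = φ s(a, b) := by
  classical
  obtain ⟨ψ, hψ⟩ := exists_potential (G := G.restrictTo (G.neighborSet v ∩ F)) (φ := φ) (by
    intro z c
    have h := hch.restrictTo F
    rw [restrictTo_restrictTo, isChordal_iff_isLengthChordal] at h
    exact (h c.length).labelSum_eq_zero (hφ.anti (restrictTo_mono Set.inter_subset_right)) c le_rfl)
  let φ' : Sym2 V → ZMod 2 := Sym2.lift ⟨fun a b =>
    if a = v then ψ b else if b = v then ψ a else φ s(a, b), by
      intro a b
      dsimp only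
      by_cases ha : a = v <;> by_cases hb : b = v <;> simp [ha, hb, Sym2.eq_swap]⟩
  have h1 : ∀ a, φ' s(v, a) = ψ a := fun a => by simp [φ']
  have h1' : ∀ a, φ' s(a, v) = ψ a := fun a => by rw [Sym2.eq_swap, h1]
  have h2 : ∀ a ∈ F, ∀ b ∈ F, φ' s(a, b) = φ s(a, b) := by
    intro a ha b hb
    have ha' : a ≠ v := fun h => hv (h ▸ ha)
    have hb' : b ≠ v := fun h => hv (h ▸ hb)
    simp [φ', ha', hb']
  refine ⟨φ', ?_, h2⟩
  have h3 : ∀ a ∈ F, ∀ b ∈ F, G.Adj v a → G.Adj v b → G.Adj a b → φ' s(a, b) = ψ a + ψ b := by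
    intro a ha b hb hva hvb hab
    rw [h2 a ha b hb, hψ a b ⟨hab, ⟨hva, ha⟩, ⟨hvb, hb⟩⟩]
  have hmem : ∀ a, a ∈ insert v F → a ≠ v → a ∈ F := fun a h h' => h.resolve_left h'
  rintro a b c ⟨hab, ha, hb⟩ ⟨hbc, -, hc⟩ ⟨hac, -, -⟩
  by_cases hav : a = v
  · subst hav
    rw [h1, h1, h3 b (hmem b hb hab.ne') c (hmem c hc hac.ne') hab hac hbc]
    linear_combination zmodTwo_add_self (ψ b) + zmodTwo_add_self (ψ c)
  by_cases hbv : b = v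
  · subst hbv
    rw [h1, h1', h3 a (hmem a ha hav) c (hmem c hc hbc.ne') hab.symm hbc hac]
    linear_combination zmodTwo_add_self (ψ a) + zmodTwo_add_self (ψ c)
  by_cases hcv : c = v
  · subst hcv
    rw [h1', h1', h3 a (hmem a ha hav) b (hmem b hb hbv) hac.symm hbc.symm hab]
    linear_combination zmodTwo_add_self (ψ a) + zmodTwo_add_self (ψ b)
  have ha := hmem a ha hav
  have hb := hmem b hb hbv
  have hc := hmem c hc hcv
  rw [h2 a ha b hb, h2 b hb c hc, h2 a ha c hc]
  exact hφ a b c ⟨hab, ha, hb⟩ ⟨hbc, hb, hc⟩ ⟨hac, ha, hc⟩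

theorem exists_extension_cocycle_finset
    (hch : ∀ v, (G.restrictTo (G.neighborSet v)).IsChordal) {S : Set V} {φ : Sym2 V → ZMod 2}
    (hφ : (G.restrictTo S).IsCocycle φ) (F : Finset V) :
    ∃ φ' : Sym2 V → ZMod 2, (G.restrictTo (S ∪ F)).IsCocycle φ' ∧
      ∀ a ∈ S, ∀ b ∈ S, φ' s(a, b) = φ s(a, b) := by
  classical
  induction F using Finset.induction_on with
  | empty => exact ⟨φ, by simpa using hφ, fun _ _ _ _ => rfl⟩
  | insert v F _ ih =>
    obtain ⟨φ', h1, h2⟩ := ih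
    have he : S ∪ ((insert v F : Finset V) : Set V) = insert v (S ∪ F) := by
      rw [Finset.coe_insert, Set.union_insert]
    rw [he]
    by_cases hv : v ∈ S ∪ F
    · exact ⟨φ', by rwa [Set.insert_eq_of_mem hv], h2⟩
    · obtain ⟨φ'', h3, h4⟩ := exists_extension_cocycle hv (hch v) h1
      exact ⟨φ'', h3, fun a ha b hb => (h4 a (Or.inl ha) b (Or.inl hb)).trans (h2 a ha b hb)⟩

theorem Walk.IsCycle.eq_snd_or_penultimate {z t : V} {c : G.Walk z z} (hc : c.IsCycle)
    (h : s(z, t) ∈ c.edges) : t = c.snd ∨ t = c.penultimate := by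
  obtain ⟨i, hi, h⟩ := c.mk_mem_edges_iff_exists.1 h
  rw [Sym2.eq_iff] at h
  rcases h with ⟨h1, h2⟩ | ⟨h1, h2⟩
  · rcases (hc.getVert_endpoint_iff hi.le).1 h1 with rfl | h
    · exact Or.inl h2.symm
    · omega
  · rcases (hc.getVert_endpoint_iff hi).1 h2 with h | h
    · omega
    · right
      rw [← h1, Walk.penultimate, ← h, Nat.succ_sub_one]

/-- A graph in which all closed walks are `r`-homotopic to a constant walk is chordal if it is
`r`-chordal and the neighbourhoods of its vertices are chordal. -/
theorem isChordal_of_shortHomotopic_nil {r : ℕ} (hG : G.IsLengthChordal r)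
    (hch : ∀ v, (G.restrictTo (G.neighborSet v)).IsChordal)
    (hnull : ∀ (z : V) (c : G.Walk z z), c.ShortHomotopic r Walk.nil) : G.IsChordal := by
  classical
  intro z c hc h4
  by_contra hcon
  push Not at hcon
  set S : Set V := {t | t ∈ c.support} with hS
  let φ : Sym2 V → ZMod 2 := fun e => if e = s(z, c.snd) then 1 else 0
  -- Without chords, a triangle on the first edge of `c` would consist of edges of `c`. Its third
  -- vertex would be `c.penultimate`, which no edge of `c` joins to `c.snd`.
  have htri : ∀ a b t, a ∈ S → b ∈ S → t ∈ S → G.Adj a b → G.Adj b t → G.Adj a t →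
      s(a, b) = s(z, c.snd) → False := by
    have aux : ∀ t ∈ S, G.Adj z t → G.Adj c.snd t → False := by
      intro t ht hzt hst
      have h1 := hcon z (by simp) t ht hzt
      have h2 := hcon c.snd (c.getVert_mem_support 1) t ht hst
      rcases hc.eq_snd_or_penultimate h1 with rfl | rfl
      · exact hst.ne rfl
      · exact hc.snd_penultimate_notMem_edges h4 h2
    intro a b t ha hb ht hab hbt hat he
    rw [Sym2.eq_iff] at he
    rcases he with ⟨rfl, rfl⟩ | ⟨rfl, rfl⟩
    · exact aux t ht hat hbt
    · exact aux t ht hbt hat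
  have hφ : (G.restrictTo S).IsCocycle φ := by
    rintro a b t ⟨hab, ha, hb⟩ ⟨hbt, -, ht⟩ ⟨hat, -, -⟩
    have e1 := htri a b t ha hb ht hab hbt hat
    have e2 := htri b t a hb ht ha hbt hat.symm hab.symm
    have e3 := htri a t b ha ht hb hat hbt.symm hab
    simp only [φ, if_neg e1, if_neg e2, if_neg e3, add_zero]
  obtain ⟨F, hF⟩ := (hnull z c).labelSum_eq hG
  obtain ⟨φ', h1, h2⟩ := exists_extension_cocycle_finset hch hφ F
  have hzero := hF φ' (h1.anti (restrictTo_mono Set.subset_union_right))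
  have hsum : c.labelSum φ' = c.labelSum φ := by
    unfold Walk.labelSum
    congr 1
    refine List.map_congr_left fun e he => ?_
    induction e with
    | _ x y => exact h2 x (c.fst_mem_support_of_mem_edges he) y (c.snd_mem_support_of_mem_edges he)
  rw [hsum, Walk.labelSum_nil] at hzero
  have hone : c.labelSum φ = 1 := by
    cases c with
    | nil => simp at h4
    | @cons _ y _ h p =>
      have hp := ((Walk.cons_isCycle_iff p h).1 hc).2
      have : p.labelSum φ = 0 := by
        unfold Walk.labelSum
        refine List.sum_eq_zero fun x hx => ?_
        obtain ⟨e, he, rfl⟩ := List.mem_map.1 hx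
        have : e ≠ s(z, y) := fun h => hp (h ▸ he)
        simp [φ, this]
      rw [Walk.labelSum_cons, this]
      simp [φ]
  rw [hone] at hzero
  exact one_ne_zero hzero

theorem cycleGraph_adj_iff {n : ℕ} (i j : Fin n) (hn : 2 ≤ n) : (cycleGraph n).Adj i j ↔
    (i : ℕ) + 1 = j ∨ (j : ℕ) + 1 = i ∨ ((i : ℕ) = 0 ∧ (j : ℕ) + 1 = n) ∨
      ((j : ℕ) = 0 ∧ (i : ℕ) + 1 = n) := by
  rw [cycleGraph_adj']
  have hi := i.2
  have hj := j.2
  rcases lt_trichotomy i j with h | rfl | h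
  · rw [Fin.coe_sub_iff_lt.2 h, Fin.coe_sub_iff_le.2 h.le]
    have : (i : ℕ) < j := h
    omega
  · rw [Fin.coe_sub_iff_le.2 le_rfl]; omega
  · rw [Fin.coe_sub_iff_lt.2 h, Fin.coe_sub_iff_le.2 h.le]
    have : (j : ℕ) < i := h
    omega

theorem Walk.IsCycle.mk_getVert_mem_edges_iff {z : V} {c : G.Walk z z} (hc : c.IsCycle)
    (i j : Fin c.length) :
    s(c.getVert i, c.getVert j) ∈ c.edges ↔ (cycleGraph c.length).Adj i j := by
  have h3 := hc.three_le_length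
  have inj : ∀ i j, i < c.length → j < c.length → c.getVert i = c.getVert j → i = j :=
    fun i j hi hj h => hc.getVert_injOn' (by simp; omega) (by simp; omega) h
  have inj' : ∀ i j, i < c.length → j ≤ c.length → c.getVert j = c.getVert i →
      i = j ∨ (i = 0 ∧ j = c.length) := by
    intro i j hi hj h
    rcases hj.lt_or_eq with hj | rfl
    · exact Or.inl (inj i j hi hj h.symm)
    · exact Or.inr ⟨(inj 0 i (by omega) hi (by simpa using h)).symm, rfl⟩
  rw [cycleGraph_adj_iff i j (by omega), Walk.mk_mem_edges_iff_exists]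
  have hi := i.2
  have hj := j.2
  constructor
  · rintro ⟨k, hk, h⟩
    rw [Sym2.eq_iff] at h
    rcases h with ⟨h1, h2⟩ | ⟨h1, h2⟩
    · have := inj k i hk hi h1
      have := inj' j (k + 1) hj hk h2
      omega
    · have := inj k j hk hj h1
      have := inj' i (k + 1) hi hk h2
      omega
  · rintro (h | h | ⟨h, h'⟩ | ⟨h, h'⟩)
    · exact ⟨i, hi, by rw [h]⟩
    · exact ⟨j, hj, by rw [h, Sym2.eq_swap]⟩
    · exact ⟨j, hj, by rw [h', h, Walk.getVert_length, Walk.getVert_zero, Sym2.eq_swap]⟩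
    · exact ⟨i, hi, by rw [h', h, Walk.getVert_length, Walk.getVert_zero]⟩

/-- The neighbourhoods in a wheel-free graph are chordal. -/
theorem IsWheelFree.isChordal_neighborSet (hG : G.IsWheelFree) (v : V) :
    (G.restrictTo (G.neighborSet v)).IsChordal := by
  intro z c hc h4
  by_contra hcon
  push Not at hcon
  have hz : z ∈ G.neighborSet v := by
    cases c with
    | nil => simp at h4
    | cons h p => exact h.2.1
  have hN : ∀ i, G.Adj v (c.getVert i) := fun i =>
    c.support_subset_of_restrictTo hz _ (c.getVert_mem_support i)
  refine hG c.length h4 ⟨⟨⟨fun o => o.elim v fun i => c.getVert i, ?_⟩, ?_⟩⟩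
  · rintro (_ | i) (_ | j) h
    · rfl
    · exact absurd h (hN j).ne
    · exact absurd h (hN i).ne'
    · have := hc.getVert_injOn' (by simp; omega) (by simp; omega) h
      exact congrArg some (Fin.ext this)
  · rintro (_ | i) (_ | j)
    · exact iff_of_false (G.loopless.irrefl _) id
    · exact iff_of_true (hN j) trivial
    · exact iff_of_true (hN i).symm trivial
    · change G.Adj (c.getVert i) (c.getVert j) ↔ (cycleGraph c.length).Adj i j
      rw [← hc.mk_getVert_mem_edges_iff]
      constructor
      · intro h
        exact hcon _ (c.getVert_mem_support i) _ (c.getVert_mem_support j) ⟨h, hN i, hN j⟩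
      · intro h
        exact (c.adj_of_mem_edges h).1

end Cocycles

/-! ### Minimal local separators are cliques -/

section Separators

variable {V : Type u} {G : SimpleGraph V} {r : ℕ}

/-- Distinct edges of the boundary that are related at `X` are the first and the last edge of a
walk through the complement of `X` in a short cycle. -/
theorem LocalRel.eq_or_exists_walk {X : Set V} {e f : Sym2 V} (h : G.LocalRel r X e f) :
    e = f ∨ ∃ (a p q b : V) (u : G.Walk p q) (z : V) (c : G.Walk z z), a ∈ X ∧ b ∈ X ∧
      G.Adj a p ∧ G.Adj q b ∧ (∀ t ∈ u.support, t ∉ X) ∧ e = s(a, p) ∧ f = s(q, b) ∧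
      c.IsCycle ∧ c.length ≤ r ∧ a ∈ c.support ∧ b ∈ c.support ∧ u.support ⊆ c.support := by
  obtain ⟨-, -, h | ⟨a, b, w, hw, hloc, he, hf⟩⟩ := h
  · exact Or.inl h
  cases w with
  | nil => simp at he
  | @cons _ p _ h w =>
    cases w with
    | nil =>
      left
      simp only [Walk.edges_cons, Walk.edges_nil, List.head?_cons, List.getLast?_singleton,
        Option.some.injEq] at he hf
      rw [← he, hf]
    | cons h' w =>
      right
      obtain ⟨q, u, h2, hu⟩ := Walk.exists_cons_eq_concat h' w
      rw [hu] at hw hloc he hf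
      rcases hloc with ⟨z, c, hc, hl, hle⟩ | hlen
      · have hsub : ∀ t, t ∈ (Walk.cons h (u.concat h2)).support → t ∈ c.support := by
          intro t ht
          rw [← Walk.mem_verts_toSubgraph] at ht ⊢
          exact hle.1 ht
        refine ⟨a, p, q, b, u, z, c, hw.1, hw.2.1, h, h2, ?_, ?_, ?_, hc, hl,
          hsub _ (by simp), hsub _ (by simp), fun t ht => hsub t (by simp [Walk.support_concat, ht])⟩
        · intro t ht
          obtain ⟨k, rfl, hk⟩ := Walk.mem_support_iff_exists_getVert.mp ht
          have := hw.2.2 (k + 1) (by omega) (by simp; omega)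
          rw [Walk.getVert_cons_succ, Walk.concat_eq_append, Walk.getVert_append] at this
          split_ifs at this with hlt
          · exact this
          · have : k = u.length := by omega
            subst this
            simpa using this
        · simpa using he.symm
        · simpa [Walk.edges_concat, List.getLast?_cons] using hf.symm
      · simp at hlen

theorem LocalRel.symm {X : Set V} {e f : Sym2 V} (h : G.LocalRel r X e f) :
    G.LocalRel r X f e := by
  obtain ⟨he, hf, h⟩ := h
  refine ⟨hf, he, h.imp Eq.symm ?_⟩
  rintro ⟨a, b, w, ⟨ha, hb, hw⟩, hloc, h1, h2⟩
  refine ⟨b, a, w.reverse, ⟨hb, ha, ?_⟩, ?_, ?_, ?_⟩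
  · intro i hi hil
    rw [Walk.length_reverse] at hil
    rw [Walk.getVert_reverse]
    exact hw _ (by omega) (by omega)
  · rcases hloc with ⟨z, c, hc, hl, hle⟩ | hlen
    · exact Or.inl ⟨z, c, hc, hl, by rwa [Walk.toSubgraph_reverse]⟩
    · exact Or.inr (by rwa [Walk.length_reverse])
  · rw [Walk.edges_reverse, List.head?_reverse, h2]
  · rw [Walk.edges_reverse, List.getLast?_reverse, h1]

/-- On the boundary of `X` the relation is symmetric and contains equality, so its transitive
closure is an equivalence and equal classes mean related edges. -/
theorem isLocalSeparatorOf_iff {x z y : V} {X : Set V} (hzy : G.Adj z y) :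
    G.IsLocalSeparatorOf r x z y X ↔ x ∉ X ∧ y ∉ X ∧ z ∈ X ∧
      ¬ Relation.TransGen (G.LocalRel r X) s(x, z) s(z, y) := by
  unfold IsLocalSeparatorOf
  refine and_congr_right fun hx => and_congr_right fun hy => and_congr_right fun hz => not_congr ?_
  constructor
  · intro h
    have hmem : s(z, y) ∈ G.edgeCut X := ⟨z, y, rfl, hzy, hz, hy⟩
    have : s(z, y) ∈ G.localComponent r X s(z, y) := Relation.TransGen.single ⟨hmem, hmem, Or.inl rfl⟩
    rw [← h] at this
    exact this
  · intro h
    ext f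
    have hsymm : ∀ {e f}, Relation.TransGen (G.LocalRel r X) e f →
        Relation.TransGen (G.LocalRel r X) f e := fun h => by
      induction h with
      | single h => exact .single h.symm
      | tail _ h ih => exact .head h.symm ih
    exact ⟨fun hf => (hsymm h).trans hf, fun hf => h.trans hf⟩

/-- A cocycle that vanishes off the boundary of a clique is constant on local components. -/
theorem LocalRel.label_eq (hG : G.IsLengthChordal r) {K : Set V} (hK : G.IsClique K)
    {φ : Sym2 V → ZMod 2} (hφ : G.IsCocycle φ) (hin : ∀ a ∈ K, ∀ b ∈ K, φ s(a, b) = 0)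
    (hout : ∀ a, a ∉ K → ∀ b, b ∉ K → φ s(a, b) = 0) {e f : Sym2 V} (h : G.LocalRel r K e f) :
    φ e = φ f := by
  classical
  obtain rfl | ⟨a, p, q, b, u, z, c, ha, hb, hap, hqb, hu, rfl, rfl, hc, hl, hac, hbc, huc⟩ :=
    h.eq_or_exists_walk
  · rfl
  -- Replacing `u` by a path makes its vertices, together with `a` and `b`, distinct vertices of the
  -- short cycle. Counting them bounds the closed walk below by `r`.
  have hus : u.bypass.support ⊆ u.support := u.support_bypass_subset_support
  have hsum : u.bypass.labelSum φ = 0 := by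
    refine List.sum_eq_zero fun x hx => ?_
    obtain ⟨e, he, rfl⟩ := List.mem_map.1 hx
    induction e with
    | _ s t =>
      exact hout _ (hu _ (hus (Walk.fst_mem_support_of_mem_edges _ he))) _
        (hu _ (hus (Walk.snd_mem_support_of_mem_edges _ he)))
  have hcard : c.support.toFinset.card ≤ c.length := by
    have : c.support.toFinset = c.support.tail.toFinset := by
      have hz : z ∈ c.support.tail := Walk.end_mem_tail_support hc.not_nil
      ext t
      rw [← c.cons_tail_support, List.mem_toFinset, List.mem_toFinset, List.mem_cons, List.tail_cons]
      exact ⟨fun h => h.elim (fun h => h ▸ hz) id, Or.inr⟩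
    rw [this]
    refine (List.toFinset_card_le _).trans ?_
    simp
  have hucard : u.bypass.support.toFinset.card = u.bypass.length + 1 := by
    rw [List.toFinset_card_of_nodup u.bypass_isPath.support_nodup, Walk.length_support]
  have hT : ∀ T : Finset V, (∀ t ∈ T, t ∈ K ∧ t ∈ c.support) →
      u.bypass.length + 1 + T.card ≤ r := by
    intro T hT
    rw [← hucard, ← Finset.card_union_of_disjoint]
    · refine (Finset.card_le_card ?_).trans (hcard.trans hl)
      intro t ht
      rcases Finset.mem_union.1 ht with ht | ht
      · exact List.mem_toFinset.2 (huc (hus (List.mem_toFinset.1 ht)))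
      · exact List.mem_toFinset.2 (hT t ht).2
    · rw [Finset.disjoint_left]
      intro t ht ht'
      exact hu t (hus (List.mem_toFinset.1 ht)) (hT t ht').1
  by_cases hab : a = b
  · subst hab
    have h1 := hT {a} (by simp [ha, hac])
    have h2 := hG.labelSum_eq_zero hφ (Walk.cons hap (u.bypass.append (Walk.cons hqb Walk.nil)))
      (by simpa using h1)
    simp only [Walk.labelSum_cons, Walk.labelSum_append, hsum, Walk.labelSum_nil, zero_add,
      add_zero] at h2
    exact zmodTwo_eq_of_add h2
  -- The walk is closed up by the edge `ba` of the clique, which has label 0.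
  · have h1 := hT {a, b} (by simp [ha, hac, hb, hbc])
    rw [Finset.card_pair hab] at h1
    have h2 := hG.labelSum_eq_zero hφ (Walk.cons hap (u.bypass.append
      (Walk.cons hqb (Walk.cons (hK hb ha (Ne.symm hab)) Walk.nil)))) (by simp; omega)
    simp only [Walk.labelSum_cons, Walk.labelSum_append, hsum, Walk.labelSum_nil, zero_add,
      add_zero, hin b hb a ha] at h2
    exact zmodTwo_eq_of_add h2

/-- Stopping a walk at its first visit to `b` singles out the vertex `t` before it. This is used to
extract a common neighbour. -/
theorem Reachable.exists_adj_avoiding {T : Set V} {a b : V}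
    (h : (G.restrictTo T).Reachable a b) (hab : a ≠ b) :
    ∃ t, G.Adj t b ∧ t ∈ T ∧ t ≠ b ∧ (G.restrictTo (T \ {b})).Reachable a t := by
  obtain ⟨w⟩ := h
  induction w with
  | nil => exact absurd rfl hab
  | @cons x y z hxy p ih =>
    by_cases hyz : y = z
    · subst hyz
      exact ⟨x, hxy.1, hxy.2.1, hab, Reachable.refl _⟩
    · obtain ⟨t, h1, h2, h3, h4⟩ := ih hyz
      exact ⟨t, h1, h2, h3, (Adj.reachable (G := G.restrictTo (T \ {z})) ⟨hxy.1, ⟨hxy.2.1, hab⟩, hxy.2.2, hyz⟩).trans h4⟩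

/-- In the chordal neighbourhood of `p`, which contains `q`, a connection between neighbours of `q`
that avoids `q` can be moved into the neighbourhood of `q`. -/
theorem reachable_neighborSet_diff_of_mem
    (hch : ∀ v, (G.restrictTo (G.neighborSet v)).IsChordal) {K : Set V}
    {p q c d : V} (hq : q ∈ K)
    (hpq : G.Adj p q) (hpc : G.Adj p c) (hqc : G.Adj q c) (hpd : G.Adj p d) (hqd : G.Adj q d)
    (hc : c ∉ K) (h : (G.restrictTo (G.neighborSet p \ K)).Reachable c d) :
    (G.restrictTo (G.neighborSet q \ K)).Reachable c d := by
  have h' := (hch p).reachable_inter_neighborSet (S := G.neighborSet p \ K) (v := q) (c := c)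
    (d := d) (fun h => h.2 hq) ⟨hpc, hc⟩ ⟨hqc, hpq, hpc⟩ ⟨hqd, hpq, hpd⟩ (by
      rw [restrictTo_restrictTo]
      exact h.mono (restrictTo_mono fun t ht => ⟨ht.1, ht⟩))
  rw [restrictTo_restrictTo] at h'
  exact h'.mono (restrictTo_mono fun t ht => ⟨ht.2.2.1, ht.2.1.2⟩)

/-- The edge from `a ∈ K` to `c` is on the side of `x`, as seen from `z ∈ K`. -/
def OnSide (G : SimpleGraph V) (K : Set V) (x z a c : V) : Prop :=
  ∃ c', G.Adj z c' ∧ G.Adj a c' ∧ c' ∉ K ∧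
    (G.restrictTo (G.neighborSet z \ K)).Reachable x c' ∧
    (G.restrictTo (G.neighborSet a \ K)).Reachable c' c

theorem OnSide.of_adj {K : Set V} {x z a c d : V} (h : G.OnSide K x z a c) (hac : G.Adj a c)
    (had : G.Adj a d) (hc : c ∉ K) (hd : d ∉ K) (hcd : G.Adj c d) : G.OnSide K x z a d := by
  obtain ⟨c', h1, h2, h3, h4, h5⟩ := h
  exact ⟨c', h1, h2, h3, h4, h5.trans (Adj.reachable ⟨hcd, ⟨hac, hc⟩, had, hd⟩)⟩

/-- This handles the triangles with two vertices in `K`. When `a`, `b` and `z` are distinct, the new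
witness is a common neighbour `t` of `a`, `b` and `z` outside `K`, found in the chordal
neighbourhood of `a`. -/
theorem OnSide.of_mem (hch : ∀ v, (G.restrictTo (G.neighborSet v)).IsChordal)
    {K : Set V} (hK : G.IsClique K) {x z a b c : V} (hz : z ∈ K) (ha : a ∈ K) (hb : b ∈ K)
    (hab : G.Adj a b) (hac : G.Adj a c) (hbc : G.Adj b c) (hc : c ∉ K)
    (h : G.OnSide K x z a c) : G.OnSide K x z b c := by
  obtain ⟨c', h1, h2, h3, h4, h5⟩ := h
  by_cases haz : a = z
  · subst haz
    exact ⟨c, hac, hbc, hc, h4.trans h5, Reachable.refl _⟩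
  have hadj : G.Adj a z := hK ha hz haz
  by_cases hbz : b = z
  · subst hbz
    exact ⟨c, hbc, hbc, hc, h4.trans (reachable_neighborSet_diff_of_mem hch hz hadj h2 h1 hac hbc
      h3 h5), Reachable.refl _⟩
  have hzb : G.Adj z b := hK hz hb (Ne.symm hbz)
  -- Adding `b` turns the connection from `c'` to `c` into one between two neighbours of `z`. It can
  -- then be moved into the neighbourhood of `z`, and `t` is its last vertex before `b`.
  set S : Set V := insert b (G.neighborSet a \ K) with hS
  have hcS : c ∈ S := Or.inr ⟨hac, hc⟩
  have hr : ((G.restrictTo (G.neighborSet a)).restrictTo S).Reachable c' b := by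
    rw [restrictTo_restrictTo]
    refine Reachable.trans (h5.mono (restrictTo_mono fun t ht => ⟨ht.1, Or.inr ht⟩)) ?_
    exact Adj.reachable ⟨hbc.symm, ⟨hac, hcS⟩, hab, Or.inl rfl⟩
  have hr' := (hch a).reachable_inter_neighborSet (v := z) (S := S) (fun h => h.elim
    (fun h => hbz h.symm) (fun h => h.2 hz)) (Or.inr ⟨h2, h3⟩) ⟨h1, hadj, h2⟩ ⟨hzb, hadj, hab⟩ hr
  rw [restrictTo_restrictTo] at hr'
  obtain ⟨t, ht1, ht2, ht3, ht4⟩ := hr'.exists_adj_avoiding (fun h => h3 (h ▸ hb))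
  have htK : t ∉ K := (ht2.2.1.resolve_left ht3).2
  have hsub : ∀ s, s ∈ (G.neighborSet a ∩ (S ∩ (G.restrictTo (G.neighborSet a)).neighborSet z)) \ {b} →
      s ∈ G.neighborSet a \ K ∧ s ∈ G.neighborSet z \ K := by
    rintro s ⟨⟨h1, h2, h3⟩, h4⟩
    have := h2.resolve_left h4
    exact ⟨this, h3.1, this.2⟩
  have hta : (G.restrictTo (G.neighborSet a \ K)).Reachable t c :=
    (Reachable.symm (ht4.mono (restrictTo_mono fun s hs => (hsub s hs).1))).trans h5
  refine ⟨t, ht2.2.2.1, ht1.symm, htK,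
    h4.trans (ht4.mono (restrictTo_mono fun s hs => (hsub s hs).2)), ?_⟩
  exact reachable_neighborSet_diff_of_mem hch hb hab ht2.1 ht1.symm hac hbc htK hta

/-- A clique that separates two neighbours of one of its vertices `z` in the neighbourhood
of `z` separates them locally. -/
theorem IsClique.isLocalSeparatorOf
    (hch : ∀ v, (G.restrictTo (G.neighborSet v)).IsChordal)
    (hG : G.IsLengthChordal r) {K : Set V} (hK : G.IsClique K) {x z y : V}
    (hz : z ∈ K) (hx : x ∉ K) (hy : y ∉ K) (hxz : G.Adj x z) (hzy : G.Adj z y)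
    (hsep : ¬ (G.restrictTo (G.neighborSet z \ K)).Reachable x y) :
    G.IsLocalSeparatorOf r x z y K := by
  classical
  rw [isLocalSeparatorOf_iff hzy]
  refine ⟨hx, hy, hz, fun htrans => ?_⟩
  -- The label marks the boundary edges of `K` on the side of `x`. As a cocycle it is constant on
  -- local components, while `xz` has label 1 and `zy` label 0.
  let φ : Sym2 V → ZMod 2 := fun e =>
    if ∃ a c, a ∈ K ∧ c ∉ K ∧ G.OnSide K x z a c ∧ e = s(a, c) then 1 else 0
  have hin : ∀ a ∈ K, ∀ b ∈ K, φ s(a, b) = 0 := by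
    intro a ha b hb
    refine if_neg ?_
    rintro ⟨a', c, -, hc, -, h⟩
    rcases Sym2.eq_iff.1 h with ⟨-, rfl⟩ | ⟨rfl, -⟩
    · exact hc hb
    · exact hc ha
  have hout : ∀ a, a ∉ K → ∀ b, b ∉ K → φ s(a, b) = 0 := by
    intro a ha b hb
    refine if_neg ?_
    rintro ⟨a', c, ha', -, -, h⟩
    rcases Sym2.eq_iff.1 h with ⟨rfl, -⟩ | ⟨-, rfl⟩
    · exact ha ha'
    · exact hb ha'
  have hcut : ∀ a ∈ K, ∀ c, c ∉ K → φ s(a, c) = if G.OnSide K x z a c then 1 else 0 := by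
    intro a ha c hc
    refine if_congr ⟨?_, fun h => ⟨a, c, ha, hc, h, rfl⟩⟩ rfl rfl
    rintro ⟨a', c', ha', hc', h, he⟩
    rcases Sym2.eq_iff.1 he with ⟨rfl, rfl⟩ | ⟨rfl, rfl⟩
    · exact h
    · exact absurd ha hc'
  have hcut' : ∀ c, c ∉ K → ∀ a ∈ K, φ s(c, a) = if G.OnSide K x z a c then 1 else 0 := by
    intro c hc a ha
    rw [Sym2.eq_swap, hcut a ha c hc]
  have hone : ∀ a c d, a ∈ K → c ∉ K → d ∉ K → G.Adj a c → G.Adj a d → G.Adj c d →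
      (G.OnSide K x z a c ↔ G.OnSide K x z a d) := fun a c d ha hc hd hac had hcd =>
    ⟨fun h => h.of_adj hac had hc hd hcd, fun h => h.of_adj had hac hd hc hcd.symm⟩
  have htwo : ∀ a b c, a ∈ K → b ∈ K → c ∉ K → G.Adj a b → G.Adj a c → G.Adj b c →
      (G.OnSide K x z a c ↔ G.OnSide K x z b c) := fun a b c ha hb hc hab hac hbc =>
    ⟨fun h => h.of_mem hch hK hz ha hb hab hac hbc hc,
      fun h => h.of_mem hch hK hz hb ha hab.symm hbc hac hc⟩
  have hφ : G.IsCocycle φ := by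
    intro a b c hab hbc hac
    by_cases ha : a ∈ K <;> by_cases hb : b ∈ K <;> by_cases hc : c ∈ K
    · rw [hin a ha b hb, hin b hb c hc, hin a ha c hc]; rfl
    · rw [hin a ha b hb, hcut b hb c hc, hcut a ha c hc, htwo a b c ha hb hc hab hac hbc,
        zero_add, zmodTwo_add_self]
    · rw [hcut a ha b hb, hcut' b hb c hc, hin a ha c hc, htwo a c b ha hc hb hac hab hbc.symm,
        add_zero, zmodTwo_add_self]
    · rw [hcut a ha b hb, hout b hb c hc, hcut a ha c hc, hone a b c ha hb hc hab hac hbc,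
        add_zero, zmodTwo_add_self]
    · rw [hcut' a ha b hb, hin b hb c hc, hcut' a ha c hc, htwo b c a hb hc ha hbc hab.symm hac.symm,
        add_zero, zmodTwo_add_self]
    · rw [hcut' a ha b hb, hcut b hb c hc, hout a ha c hc, hone b a c hb ha hc hab.symm hbc hac,
        add_zero, zmodTwo_add_self]
    · rw [hout a ha b hb, hcut' b hb c hc, hcut' a ha c hc, hone c a b hc ha hb hac.symm hbc.symm hab,
        zero_add, zmodTwo_add_self]
    · rw [hout a ha b hb, hout b hb c hc, hout a ha c hc]; rfl
  have hconst : φ s(x, z) = φ s(z, y) := by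
    generalize s(x, z) = e, s(z, y) = f at htrans
    induction htrans with
    | single h => exact h.label_eq hG hK hφ hin hout
    | tail _ h ih => exact ih.trans (h.label_eq hG hK hφ hin hout)
  rw [hcut' x hx z hz, hcut z hz y hy, if_pos ⟨x, hxz.symm, hxz.symm, hx, Reachable.refl _,
    Reachable.refl _⟩, if_neg] at hconst
  · exact one_ne_zero hconst
  · rintro ⟨c', -, -, -, h1, h2⟩
    exact hsep (h1.trans h2)

/-- Two edges of the boundary with a common end in `X` are related if their other ends are
adjacent. -/
theorem LocalRel.of_triangle (hr : 3 ≤ r) {X : Set V} {z c d : V} (hz : z ∈ X) (hc : c ∉ X)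
    (hd : d ∉ X) (hzc : G.Adj z c) (hzd : G.Adj z d) (hcd : G.Adj c d) :
    G.LocalRel r X s(z, c) s(z, d) := by
  refine ⟨⟨z, c, rfl, hzc, hz, hc⟩, ⟨z, d, rfl, hzd, hz, hd⟩, Or.inr ⟨z, z,
    Walk.cons hzc (Walk.cons hcd (Walk.cons hzd.symm Walk.nil)), ⟨hz, hz, ?_⟩, Or.inl ⟨z,
    Walk.cons hzc (Walk.cons hcd (Walk.cons hzd.symm Walk.nil)), ?_, by simpa using hr, le_rfl⟩,
    by simp, by simp [Sym2.eq_swap]⟩⟩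
  · intro i h1 h2
    have h2' : i < 3 := by simpa using h2
    interval_cases i
    · simpa using hc
    · simpa using hd
  · rw [Walk.isCycle_iff_isPath_tail_and_le_length]
    simp [hcd.ne, hzd.ne', hzc.ne']

/-- In an `r`-chordal wheel-free graph, minimal `r`-local separators are cliques. -/
theorem IsMinimalLocalSeparator.isClique (hr : 3 ≤ r) (hG : G.IsLengthChordal r)
    (hch : ∀ v, (G.restrictTo (G.neighborSet v)).IsChordal) {X : Set V}
    (hX : G.IsMinimalLocalSeparator r X) : G.IsClique X := by
  obtain ⟨x, z, y, -, hxz, hzy, hmin⟩ := hX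
  obtain ⟨hx, hy, hz, hnot⟩ := (isLocalSeparatorOf_iff hzy).1 hmin.1
  -- Each edge of a walk from `x` to `y` among neighbours of `z` off `X` forms a triangle with `z`,
  -- and such triangles would link `xz` to `zy`.
  have hsep : ¬ ((G.restrictTo (G.neighborSet z)).restrictTo Xᶜ).Reachable x y := by
    intro h
    rw [restrictTo_restrictTo] at h
    have hmem : s(x, z) ∈ G.edgeCut X := ⟨z, x, Sym2.eq_swap, hxz.symm, hz, hx⟩
    apply hnot
    refine Reachable.induct (P := fun t => Relation.TransGen (G.LocalRel r X) s(x, z) s(z, t))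
      (fun a b h hab => hab.tail ?_) h (.single ?_)
    · exact LocalRel.of_triangle hr hz h.2.1.2 h.2.2.2 h.2.1.1 h.2.2.1 h.1
    · rw [Sym2.eq_swap] at hmem ⊢
      exact ⟨hmem, hmem, Or.inl rfl⟩
  obtain ⟨Y, hYX, hYc, hYn, hYs⟩ := (hch z).exists_isClique_separator hx hy hsep
  -- Each vertex of `Y` has an edge in the graph restricted to the neighbourhood of `z`, so it lies
  -- in that neighbourhood.
  have hYz : ∀ s ∈ Y, G.Adj z s := fun s hs => by
    obtain ⟨t, ht⟩ := hYn s hs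
    exact ht.2.1
  have hK : G.IsClique (insert z Y) :=
    IsClique.insert (fun a ha b hb hab => (hYc ha hb hab).1) fun b hb _ => hYz b hb
  have hKX : insert z Y ⊆ X := Set.insert_subset hz hYX
  have := hK.isLocalSeparatorOf hch hG (Or.inl rfl) (fun h => hx (hKX h)) (fun h => hy (hKX h))
    hxz hzy (fun h => hYs (by
      rw [restrictTo_restrictTo]
      exact h.mono (restrictTo_mono fun t ht => ⟨ht.1, fun h => ht.2 (Or.inr h)⟩)))
  have hle := hmin.2 this hKX
  exact hK.subset hle

end Separators

/-! ### Existence of minimal local separators, and what follows if they are cliques -/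

section MinimalSeparators

variable {V : Type u} {G : SimpleGraph V} {r : ℕ}

/-- A chain of local relations at `Y` survives at a larger set that agrees with `Y` on finitely
many vertices. -/
theorem exists_finset_transGen_localRel {Y : Set V} {e f : Sym2 V}
    (h : Relation.TransGen (G.LocalRel r Y) e f) :
    ∃ F : Finset V, ∀ X : Set V, Y ⊆ X → (∀ t ∈ F, t ∈ X → t ∈ Y) →
      Relation.TransGen (G.LocalRel r X) e f := by
  classical
  -- A boundary edge of `Y` stays in the boundary of a larger set as long as its outer end `t` stays
  -- outside.
  have cut : ∀ e ∈ G.edgeCut Y, ∃ t : V, ∀ X : Set V, Y ⊆ X → (t ∈ X → t ∈ Y) →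
      e ∈ G.edgeCut X := by
    rintro _ ⟨a, b, rfl, hab, ha, hb⟩
    exact ⟨b, fun X hX ht => ⟨a, b, rfl, hab, hX ha, fun h => hb (ht h)⟩⟩
  have step : ∀ e f, G.LocalRel r Y e f → ∃ F : Finset V, ∀ X : Set V, Y ⊆ X →
      (∀ t ∈ F, t ∈ X → t ∈ Y) → G.LocalRel r X e f := by
    rintro e f ⟨he, hf, h⟩
    obtain ⟨s, hs⟩ := cut e he
    obtain ⟨t, ht⟩ := cut f hf
    rcases h with h | ⟨a, b, w, ⟨ha, hb, hw⟩, hloc, h1, h2⟩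
    · refine ⟨{s, t}, fun X hX hF => ⟨hs X hX (hF s (by simp)), ht X hX (hF t (by simp)), Or.inl h⟩⟩
    · refine ⟨insert s (insert t w.support.toFinset), fun X hX hF =>
        ⟨hs X hX (hF s (by simp)), ht X hX (hF t (by simp)), Or.inr ⟨a, b, w, ⟨hX ha, hX hb, ?_⟩,
          hloc, h1, h2⟩⟩⟩
      intro i hi hil hiX
      exact hw i hi hil (hF _ (by simp [w.getVert_mem_support]) hiX)
  induction h with
  | single h =>
    obtain ⟨F, hF⟩ := step _ _ h
    exact ⟨F, fun X hX h => .single (hF X hX h)⟩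
  | tail _ h ih =>
    obtain ⟨F, hF⟩ := step _ _ h
    obtain ⟨F', hF'⟩ := ih
    exact ⟨F ∪ F', fun X hX h => (hF' X hX fun t ht => h t (Finset.mem_union_right _ ht)).tail
      (hF X hX fun t ht => h t (Finset.mem_union_left _ ht))⟩

/-- The interior of a walk through the complement of this set stays in `{x, y}`. As `x` and `y` are
nonadjacent, it cannot pass from one to the other. -/
theorem isLocalSeparatorOf_compl_pair {x z y : V} (hxz : G.Adj x z) (hzy : G.Adj z y)
    (hxy : x ≠ y) (hnadj : ¬ G.Adj x y) : G.IsLocalSeparatorOf r x z y {x, y}ᶜ := by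
  rw [isLocalSeparatorOf_iff hzy]
  refine ⟨by simp, by simp, by simp [hxz.ne', hzy.ne], fun h => ?_⟩
  have step : ∀ e f, G.LocalRel r ({x, y}ᶜ : Set V) e f → x ∈ e → x ∈ f := by
    intro e f hef hx
    rcases hef.eq_or_exists_walk with rfl | ⟨a, p, q, b, u, -, -, ha, -, -, -, hu, rfl, rfl, -⟩
    · exact hx
    have hxp : x = p := by
      rcases Sym2.mem_iff.1 hx with rfl | h
      · simp at ha
      · exact h
    cases u with
    | nil => rw [hxp]; exact Sym2.mem_mk_left _ _
    | @cons _ s _ hps u =>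
      have hs : s = x ∨ s = y := by
        by_contra hs
        exact hu s (by simp) (by simpa using hs)
      subst hxp
      rcases hs with rfl | rfl
      · exact absurd rfl hps.ne
      · exact absurd hps hnadj
  have key : x ∈ s(z, y) := by
    have h0 : x ∈ s(x, z) := Sym2.mem_mk_left _ _
    generalize s(z, y) = f at h
    induction h with
    | single h => exact step _ _ h h0
    | tail _ h ih => exact step _ _ h ih
  rcases Sym2.mem_iff.1 key with h | h
  · exact hxz.ne h
  · exact hxy h

/-- Zorn's lemma: relating the two edges takes finitely many steps, so if they were related at the
intersection of a chain, they would be related at a member of it. -/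
theorem exists_minimal_isLocalSeparatorOf {x z y : V} (hxz : G.Adj x z) (hzy : G.Adj z y)
    (hxy : x ≠ y) (hnadj : ¬ G.Adj x y) :
    ∃ X : Set V, Minimal (fun Y : Set V => G.IsLocalSeparatorOf r x z y Y) X := by
  obtain ⟨X, -, hX⟩ := zorn_superset_nonempty {Y | G.IsLocalSeparatorOf r x z y Y} (by
    intro C hC hchain hne
    refine ⟨⋂₀ C, ?_, fun s hs => Set.sInter_subset_of_mem hs⟩
    obtain ⟨X0, hX0⟩ := hne
    have h0 := (isLocalSeparatorOf_iff hzy).1 (hC hX0)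
    refine (isLocalSeparatorOf_iff hzy).2 ⟨fun h => h0.1 (h X0 hX0), fun h => h0.2.1 (h X0 hX0),
      fun X hX => ((isLocalSeparatorOf_iff hzy).1 (hC hX)).2.2.1, fun htrans => ?_⟩
    obtain ⟨F, hF⟩ := exists_finset_transGen_localRel htrans
    have : ∃ X ∈ C, ∀ t ∈ F, t ∈ X → t ∈ ⋂₀ C := by
      clear hF
      classical
      induction F using Finset.induction_on with
      | empty => exact ⟨X0, hX0, by simp⟩
      | insert s F _ ih =>
        obtain ⟨X, hX, h⟩ := ih
        by_cases hs : s ∈ ⋂₀ C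
        · refine ⟨X, hX, fun t ht htX => ?_⟩
          rcases Finset.mem_insert.1 ht with rfl | ht
          · exact hs
          · exact h t ht htX
        · simp only [Set.mem_sInter, not_forall] at hs
          obtain ⟨X', hX', hs⟩ := hs
          rcases hchain.total hX hX' with hle | hle
          · refine ⟨X, hX, fun t ht htX => ?_⟩
            rcases Finset.mem_insert.1 ht with rfl | ht
            · exact absurd (hle htX) hs
            · exact h t ht htX
          · refine ⟨X', hX', fun t ht htX => ?_⟩
            rcases Finset.mem_insert.1 ht with rfl | ht
            · exact absurd htX hs
            · exact h t ht (hle htX)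
    obtain ⟨X, hX, h⟩ := this
    exact ((isLocalSeparatorOf_iff hzy).1 (hC hX)).2.2.2 (hF X (Set.sInter_subset_of_mem hX) h))
    _ (isLocalSeparatorOf_compl_pair hxz hzy hxy hnadj)
  exact ⟨X, hX⟩

theorem dist_eq_two {x z y : V} (hxz : G.Adj x z) (hzy : G.Adj z y) (hxy : x ≠ y)
    (hnadj : ¬ G.Adj x y) : G.dist x y = 2 := by
  have h : G.edist x y = 2 := edist_eq_two_iff.2 ⟨hxy, hnadj, z, hxz, hzy.symm⟩
  rw [SimpleGraph.dist, h]
  rfl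

theorem exists_isClique_isLocalSeparatorOf
    (h : ∀ X : Set V, G.IsMinimalLocalSeparator r X → G.IsClique X) {x z y : V}
    (hxz : G.Adj x z) (hzy : G.Adj z y) (hxy : x ≠ y) (hnadj : ¬ G.Adj x y) :
    ∃ X : Set V, G.IsClique X ∧ x ∉ X ∧ y ∉ X ∧ z ∈ X ∧
      ¬ Relation.TransGen (G.LocalRel r X) s(x, z) s(z, y) := by
  obtain ⟨X, hX⟩ := exists_minimal_isLocalSeparatorOf (r := r) hxz hzy hxy hnadj
  exact ⟨X, h X ⟨x, z, y, dist_eq_two hxz hzy hxy hnadj, hxz, hzy, hX⟩,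
    (isLocalSeparatorOf_iff hzy).1 hX.1⟩

/-- On a chordless short cycle through `z`, separate the two cycle neighbours of `z` by a clique `X`
containing `z`. The cycle itself would relate the two edges at `z`, so `X` has another vertex `t` on
it; being adjacent to `z`, `t` is one of the two neighbours. -/
theorem isLengthChordal_of_isClique_minimal
    (h : ∀ X : Set V, G.IsMinimalLocalSeparator r X → G.IsClique X) : G.IsLengthChordal r := by
  intro z c hc h4 hcr
  by_contra hcon
  push Not at hcon
  have hnil : ¬ c.Nil := hc.not_nil
  have hadj1 := c.adj_snd hnil
  have hadj2 := c.adj_penultimate hnil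
  have hmem1 : c.snd ∈ c.support := c.getVert_mem_support _
  have hmem2 : c.penultimate ∈ c.support := c.getVert_mem_support _
  obtain ⟨X, hX, hx, hy, hz, hnot⟩ := exists_isClique_isLocalSeparatorOf h hadj1.symm hadj2.symm
    hc.snd_ne_penultimate
    fun hadj => hc.snd_penultimate_notMem_edges h4 (hcon _ hmem1 _ hmem2 hadj)
  have hex : ∃ t ∈ X, t ∈ c.support ∧ t ≠ z := by
    by_contra hno
    push Not at hno
    refine hnot (.single ⟨⟨z, _, Sym2.eq_swap, hadj1, hz, hx⟩, ⟨z, _, rfl, hadj2.symm, hz, hy⟩,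
      Or.inr ⟨z, z, c, ⟨hz, hz, fun i hi hil hiX => ?_⟩, Or.inl ⟨z, c, hc, hcr, le_rfl⟩, ?_, ?_⟩⟩)
    · have := (hc.getVert_endpoint_iff hil.le).1 (hno _ hiX (c.getVert_mem_support i))
      omega
    · have : c.edges = s(z, c.snd) :: c.tail.edges := by
        conv_lhs => rw [← c.cons_tail_eq hnil]
        rw [Walk.edges_cons]
      rw [this, Sym2.eq_swap]
      rfl
    · have : c.edges = c.dropLast.edges.concat s(c.penultimate, z) := by
        conv_lhs => rw [← c.concat_dropLast hadj2]
        rw [Walk.edges_concat]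
      rw [this, Sym2.eq_swap]
      simp
  obtain ⟨t, htX, htc, htz⟩ := hex
  have hzt := hX hz htX (Ne.symm htz)
  rcases hc.eq_snd_or_penultimate (hcon z (by simp) t htc hzt) with rfl | rfl
  · exact hx htX
  · exact hy htX

/-- Locally separating the rim vertices 2 and 0 at the hub requires a vertex of the separator on
either rim path between them: 1 on one side, some `j ≥ 3` on the other. These two are nonadjacent.
-/
theorem isWheelFree_of_isClique_minimal (hr : 3 ≤ r)
    (h : ∀ X : Set V, G.IsMinimalLocalSeparator r X → G.IsClique X) : G.IsWheelFree := by
  rintro n hn ⟨f⟩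
  have hub : ∀ i, G.Adj (f none) (f (some i)) := fun i => f.map_adj_iff.2 trivial
  have rim : ∀ i j : Fin n, G.Adj (f (some i)) (f (some j)) ↔
      ((i : ℕ) + 1 = j ∨ (j : ℕ) + 1 = i ∨ ((i : ℕ) = 0 ∧ (j : ℕ) + 1 = n) ∨
      ((j : ℕ) = 0 ∧ (i : ℕ) + 1 = n)) := fun i j =>
    f.map_adj_iff.trans (cycleGraph_adj_iff i j (by omega))
  let i0 : Fin n := ⟨0, by omega⟩
  let i1 : Fin n := ⟨1, by omega⟩
  let i2 : Fin n := ⟨2, by omega⟩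
  obtain ⟨X, hX, hx, hy, hz, hnot⟩ := exists_isClique_isLocalSeparatorOf h (hub i2).symm (hub i0)
    (fun he => by simpa [i0, i2] using f.injective he)
    (fun hadj => by
      have := (rim _ _).1 hadj
      simp only [i0, i2] at this
      omega)
  rw [Sym2.eq_swap] at hnot
  have h1 : f (some i1) ∈ X := by
    by_contra h1
    refine hnot ((Relation.TransGen.single ?_).tail
      (LocalRel.of_triangle hr hz h1 hy (hub i1) (hub i0) ((rim _ _).2 ?_)))
    · exact LocalRel.of_triangle hr hz hx h1 (hub i2) (hub i1) ((rim _ _).2 (by simp [i1, i2]))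
    · simp [i0, i1]
  have h2 : ∃ j : Fin n, 3 ≤ (j : ℕ) ∧ f (some j) ∈ X := by
    by_contra hno
    push Not at hno
    have hout : ∀ j : Fin n, 2 ≤ (j : ℕ) → f (some j) ∉ X := by
      intro j hj
      rcases hj.lt_or_eq with hj | hj
      · exact hno j hj
      · have : j = i2 := Fin.ext hj.symm
        exact this ▸ hx
    have chain : ∀ k, 2 ≤ k → ∀ hk : k < n,
        Relation.TransGen (G.LocalRel r X) s(f none, f (some i2)) s(f none, f (some ⟨k, hk⟩)) := by
      intro k hk
      induction k, hk using Nat.le_induction with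
      | base =>
        intro hk
        have hmem : s(f none, f (some i2)) ∈ G.edgeCut X := ⟨_, _, rfl, hub i2, hz, hx⟩
        exact .single ⟨hmem, hmem, Or.inl rfl⟩
      | succ k hk ih =>
        intro hk'
        exact (ih (by omega)).tail (LocalRel.of_triangle hr hz (hout _ hk) (hout _ (by simp; omega))
          (hub _) (hub _) ((rim _ _).2 (by simp)))
    refine hnot ((chain (n - 1) (by omega) (by omega)).tail (LocalRel.of_triangle hr hz
      (hout _ (by simp; omega)) hy (hub _) (hub _) ((rim _ _).2 ?_)))
    exact Or.inr (Or.inr (Or.inr ⟨rfl, Nat.sub_add_cancel (by omega)⟩))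
  obtain ⟨j, hj, hjX⟩ := h2
  have hne : f (some i1) ≠ f (some j) := fun he => by
    have : i1 = j := by simpa using f.injective he
    rw [← this] at hj
    simp [i1] at hj
  have := (rim _ _).1 (hX h1 hjX hne)
  simp only [i1] at this
  omega

end MinimalSeparators

/-! ### Operations on `r`-homotopies -/

section Homotopy

variable {V : Type u} {G : SimpleGraph V} {r : ℕ}

theorem Walk.ShortHomotopic.refl {a b : V} (w : G.Walk a b) : w.ShortHomotopic r w :=
  Relation.EqvGen.refl w

theorem Walk.ShortHomotopic.symm {a b : V} {w w' : G.Walk a b} (h : w.ShortHomotopic r w') :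
    w'.ShortHomotopic r w := Relation.EqvGen.symm _ _ h

theorem Walk.ShortHomotopic.trans {a b : V} {w w' w'' : G.Walk a b}
    (h : w.ShortHomotopic r w') (h' : w'.ShortHomotopic r w'') : w.ShortHomotopic r w'' :=
  Relation.EqvGen.trans _ _ _ h h'

theorem Walk.ShortHomotopic.append_left {a b c : V} (p : G.Walk a b) {w w' : G.Walk b c}
    (h : w.ShortHomotopic r w') : (p.append w).ShortHomotopic r (p.append w') := by
  induction h with
  | rel w w' h =>
    obtain ⟨m, p', l, q, hl, rfl, rfl⟩ := h
    exact .rel _ _ ⟨m, p.append p', l, q, hl, by simp [Walk.append_assoc], by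
      simp [Walk.append_assoc]⟩
  | refl w => exact .refl _
  | symm w w' _ ih => exact ih.symm
  | trans w w' w'' _ _ ih ih' => exact ih.trans ih'

theorem Walk.ShortHomotopic.append_right {a b c : V} {w w' : G.Walk a b}
    (h : w.ShortHomotopic r w') (p : G.Walk b c) :
    (w.append p).ShortHomotopic r (w'.append p) := by
  induction h with
  | rel w w' h =>
    obtain ⟨m, p', l, q, hl, rfl, rfl⟩ := h
    exact .rel _ _ ⟨m, p', l, q.append p, hl, by simp [Walk.append_assoc], by
      simp [Walk.append_assoc]⟩
  | refl w => exact .refl _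
  | symm w w' _ ih => exact ih.symm
  | trans w w' w'' _ _ ih ih' => exact ih.trans ih'

theorem Walk.ShortHomotopic.of_length_le {a b c : V} (p : G.Walk a b) {l : G.Walk b b}
    (hl : l.length ≤ r) (q : G.Walk b c) :
    (p.append (l.append q)).ShortHomotopic r (p.append q) :=
  .rel _ _ ⟨b, p, l, q, hl, rfl, rfl⟩

theorem Walk.shortHomotopic_concat_concat (hr : 2 ≤ r) {a b c : V} (p : G.Walk a b)
    (h : G.Adj b c) : ((p.concat h).concat h.symm).ShortHomotopic r p := by
  have := ShortHomotopic.of_length_le (r := r) p (l := Walk.cons h (Walk.cons h.symm Walk.nil))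
    (by simpa using hr) Walk.nil
  simpa [Walk.concat_eq_append, ← Walk.append_assoc] using this

theorem Walk.reverse_append_shortHomotopic_nil (hr : 2 ≤ r) {a b : V} (w : G.Walk a b) :
    (w.reverse.append w).ShortHomotopic r Walk.nil := by
  induction w with
  | nil => exact .refl _
  | cons h p ih =>
    have := ShortHomotopic.of_length_le (r := r) p.reverse
      (l := Walk.cons h.symm (Walk.cons h Walk.nil)) (by simpa using hr) p
    simp only [Walk.cons_append, Walk.nil_append] at this
    rw [Walk.reverse_cons, ← Walk.append_assoc]
    exact this.trans ih

end Homotopy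

/-! ### Lifting walks and homotopies; ball-preserving coverings -/

section Lifts

variable {W : Type u} {V : Type v} {H : SimpleGraph W} {G : SimpleGraph V} {p : H →g G} {r : ℕ}

/-- A homomorphism that maps the edges at each vertex bijectively to the edges at its image. -/
def IsLocalBijection (p : H →g G) : Prop :=
  ∀ x : W, Set.BijOn p (H.neighborSet x) (G.neighborSet (p x))

/-- The walk `w` is a lift of the walk `w'`. -/
def IsLift (p : H →g G) {x y : W} {a b : V} (w : H.Walk x y) (w' : G.Walk a b) : Prop :=
  w.support.map p = w'.support

theorem IsLift.start_eq {x y : W} {a b : V} {w : H.Walk x y} {w' : G.Walk a b}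
    (h : IsLift p w w') : p x = a := by
  have : (w.support.map p).head? = w'.support.head? := congrArg _ h
  rw [← w.cons_tail_support, ← w'.cons_tail_support] at this
  simpa only [List.map_cons, List.head?_cons, Option.some.injEq] using this

theorem IsLift.reverse {x y : W} {a b : V} {w : H.Walk x y} {w' : G.Walk a b}
    (h : IsLift p w w') : IsLift p w.reverse w'.reverse := by
  unfold IsLift at *
  rw [Walk.support_reverse, Walk.support_reverse, ← h, List.map_reverse]

theorem IsLift.end_eq {x y : W} {a b : V} {w : H.Walk x y} {w' : G.Walk a b}
    (h : IsLift p w w') : p y = b := h.reverse.start_eq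

theorem IsLift.length_eq {x y : W} {a b : V} {w : H.Walk x y} {w' : G.Walk a b}
    (h : IsLift p w w') : w.length = w'.length := by
  have := congrArg List.length h
  simpa using this

theorem IsLift.append {x y z : W} {a b c : V} {w₁ : H.Walk x y} {w₂ : H.Walk y z}
    {w₁' : G.Walk a b} {w₂' : G.Walk b c} (h₁ : IsLift p w₁ w₁') (h₂ : IsLift p w₂ w₂') :
    IsLift p (w₁.append w₂) (w₁'.append w₂') := by
  unfold IsLift at *
  rw [Walk.support_append, Walk.support_append, List.map_append, h₁, List.map_tail, h₂]

theorem isLift_map {x y : W} (w : H.Walk x y) : IsLift p w (w.map p) := by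
  unfold IsLift
  rw [Walk.support_map]

theorem isLift_nil {x : W} : IsLift p (Walk.nil : H.Walk x x) (Walk.nil : G.Walk (p x) (p x)) :=
  rfl

theorem exists_isLift (hp : ∀ x b, G.Adj (p x) b → ∃ y, H.Adj x y ∧ p y = b) {a b : V}
    (w : G.Walk a b) {x : W} (hx : p x = a) : ∃ (y : W) (w' : H.Walk x y), IsLift p w' w := by
  induction w generalizing x with
  | nil => exact ⟨x, .nil, by simp [IsLift, hx]⟩
  | cons h w ih =>
    obtain ⟨y, hy, rfl⟩ := hp x _ (hx ▸ h)
    obtain ⟨z, w', hw'⟩ := ih rfl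
    refine ⟨z, .cons hy w', ?_⟩
    unfold IsLift at *
    rw [Walk.support_cons, List.map_cons, hw', hx, Walk.support_cons]

theorem IsLocalBijection.exists_adj (hp : IsLocalBijection p) (x : W) (b : V)
    (h : G.Adj (p x) b) : ∃ y, H.Adj x y ∧ p y = b := (hp x).surjOn h

theorem IsLocalBijection.exists_isLift (hp : IsLocalBijection p) {a b : V}
    (w : G.Walk a b) {x : W} (hx : p x = a) : ∃ (y : W) (w' : H.Walk x y), IsLift p w' w :=
  SimpleGraph.exists_isLift hp.exists_adj w hx

theorem IsLocalBijection.support_eq (hp : IsLocalBijection p) {x y y' : W} (w : H.Walk x y)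
    (w' : H.Walk x y') (h : w.support.map p = w'.support.map p) : w.support = w'.support := by
  induction w with
  | nil =>
    cases w' with
    | nil => rfl
    | cons h' q => simp at h
  | @cons x s y hxs q ih =>
    cases w' with
    | nil => simp at h
    | @cons _ s' _ hxs' q' =>
      simp only [Walk.support_cons, List.map_cons, List.cons.injEq, true_and] at h ⊢
      have : s = s' := by
        refine (hp x).injOn hxs hxs' ?_
        rw [← q.cons_tail_support, ← q'.cons_tail_support] at h
        simp only [List.map_cons, List.cons.injEq] at h
        exact h.1
      subst this
      exact ih q' h

theorem IsLocalBijection.end_unique (hp : IsLocalBijection p) {x y y' : W} {a b : V}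
    {w : H.Walk x y} {w' : H.Walk x y'} {w₀ : G.Walk a b} (h : IsLift p w w₀)
    (h' : IsLift p w' w₀) : y = y' := by
  have := hp.support_eq w w' (h.trans h'.symm)
  have h2 : w.support.getLast? = w'.support.getLast? := congrArg _ this
  rw [List.getLast?_eq_some_getLast w.support_ne_nil,
    List.getLast?_eq_some_getLast w'.support_ne_nil] at h2
  simpa using h2

theorem IsLocalBijection.lift_unique (hp : IsLocalBijection p) {x y : W} {a b : V}
    {w : H.Walk x y} {w' : H.Walk x y} {w₀ : G.Walk a b} (h : IsLift p w w₀)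
    (h' : IsLift p w' w₀) : w = w' :=
  Walk.ext_support (hp.support_eq w w' (h.trans h'.symm))

/-- Walks of length at most `r` whose ends have the same image are closed. -/
def ClosesShortWalks (r : ℕ) (p : H →g G) : Prop :=
  ∀ ⦃x y : W⦄ (w : H.Walk x y), w.length ≤ r → p x = p y → x = y

/-- A closed walk of length at most `r` lifts to a closed walk, so each elementary homotopy lifts.
That the lifts end at the same vertex is part of the conclusion, hence the `copy`. -/
theorem Walk.ShortHomotopic.lift (hp : IsLocalBijection p) (hs : ClosesShortWalks r p) {a b : V}
    {w₀ w₀' : G.Walk a b} (h : w₀.ShortHomotopic r w₀') {x y y' : W} {w : H.Walk x y}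
    {w' : H.Walk x y'} (hw : IsLift p w w₀) (hw' : IsLift p w' w₀') :
    ∃ hy : y = y', (w.copy rfl hy).ShortHomotopic r w' := by
  induction h generalizing y y' with
  | rel w₀ w₀' h =>
    obtain ⟨m, p₀, l, q, hl, rfl, rfl⟩ := h
    obtain ⟨m', p', hp'⟩ := hp.exists_isLift p₀ hw.start_eq
    obtain ⟨m'', l', hl'⟩ := hp.exists_isLift l hp'.end_eq
    obtain rfl := hs l' (hl'.length_eq.trans_le hl) (hl'.start_eq.trans hl'.end_eq.symm)
    obtain ⟨z, q', hq'⟩ := hp.exists_isLift q hp'.end_eq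
    have h1 := hp'.append (hl'.append hq')
    have h2 := hp'.append hq'
    obtain rfl := hp.end_unique hw h1
    obtain rfl := hp.end_unique hw' h2
    refine ⟨rfl, ?_⟩
    rw [Walk.copy_rfl_rfl, hp.lift_unique hw h1, hp.lift_unique hw' h2]
    exact Walk.ShortHomotopic.of_length_le _ (hl'.length_eq.trans_le hl) _
  | refl w₀ =>
    obtain rfl := hp.end_unique hw hw'
    exact ⟨rfl, hp.lift_unique hw hw' ▸ .refl _⟩
  | symm w₀ w₀' _ ih =>
    obtain ⟨rfl, h⟩ := ih hw' hw
    exact ⟨rfl, h.symm⟩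
  | trans w₀ w₁ w₂ _ _ ih ih' =>
    obtain ⟨z, w'', h''⟩ := hp.exists_isLift w₁ hw.start_eq
    obtain ⟨rfl, h⟩ := ih hw h''
    obtain ⟨rfl, h'⟩ := ih' h'' hw'
    exact ⟨rfl, h.trans h'⟩

theorem mem_halfBall_iff {a x : V} :
    a ∈ (G.halfBall r x).verts ↔ ∃ w : G.Walk x a, 2 * w.length ≤ r := by
  change 2 * G.edist x a ≤ r ↔ _
  constructor
  · intro h
    have hne : G.edist x a ≠ ⊤ := by
      intro h'
      rw [h', ENat.mul_top (by norm_num)] at h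
      exact absurd h (by simp)
    obtain ⟨w, hw⟩ := exists_walk_of_edist_ne_top hne
    refine ⟨w, ?_⟩
    rw [← hw] at h
    exact_mod_cast h
  · rintro ⟨w, hw⟩
    calc 2 * G.edist x a ≤ 2 * (w.length : ℕ∞) := by gcongr; exact w.edist_le
      _ ≤ r := by exact_mod_cast hw

theorem halfBall_adj_iff {a b x : V} : (G.halfBall r x).Adj a b ↔ G.Adj a b ∧
    ∃ (w : G.Walk x a) (w' : G.Walk x b), 2 * w.length ≤ r ∧ 2 * w'.length ≤ r ∧
      w.length + w'.length < r := by
  constructor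
  · rintro ⟨h, ha, hb, hab⟩
    refine ⟨h, ?_⟩
    have hna : G.edist x a ≠ ⊤ := fun h' => by simp [h'] at hab
    have hnb : G.edist x b ≠ ⊤ := fun h' => by simp [h'] at hab
    obtain ⟨w, hw⟩ := exists_walk_of_edist_ne_top hna
    obtain ⟨w', hw'⟩ := exists_walk_of_edist_ne_top hnb
    rw [← hw] at ha hab
    rw [← hw'] at hb hab
    exact ⟨w, w', by exact_mod_cast ha, by exact_mod_cast hb, by exact_mod_cast hab⟩
  · rintro ⟨h, w, w', h1, h2, h3⟩
    refine ⟨h, mem_halfBall_iff.2 ⟨w, h1⟩, mem_halfBall_iff.2 ⟨w', h2⟩, ?_⟩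
    calc G.edist x a + G.edist x b ≤ (w.length : ℕ∞) + w'.length := by
          gcongr
          · exact w.edist_le
          · exact w'.edist_le
      _ < r := by exact_mod_cast h3

/-- Cut `w` into halves `w₁` and `w₂` around a middle piece `q` of length 0 or 1. The reverse of the
image of `w₂`, lifted from `x`, also ends at `n`, by comparison with `w₁` in the ball around `x`.
Uniqueness of lifts from `n` then gives `x = y`. -/
theorem IsBallPreserving.closesShortWalks (hp : IsLocalBijection p)
    (hb : IsBallPreserving r p) : ClosesShortWalks r p := by
  intro x y w hw hxy
  obtain ⟨w₁, q, w₂, he, h1, h2, h3⟩ := w.exists_eq_append_append (i := w.length / 2)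
    (j := w.length - w.length / 2) (by omega) (by omega) rfl rfl
  generalize w.getVert (w.length / 2) = m at w₁ q he h1 h2
  generalize w.getVert (w.length - w.length / 2) = n at q w₂ he h2 h3
  obtain ⟨n', w', hw'⟩ := hp.exists_isLift (w₂.map p).reverse hxy
  have hl := hw'.length_eq
  rw [Walk.length_reverse, Walk.length_map] at hl
  have hpn : p n' = p n := hw'.end_eq
  have hn : n' = n := by
    cases q with
    | nil =>
      exact (hb x).1.injOn (mem_halfBall_iff.2 ⟨w', by omega⟩) (mem_halfBall_iff.2 ⟨w₁, by omega⟩)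
        hpn
    | cons h q =>
      rw [Walk.length_cons] at h2
      have hq : q.length = 0 := by omega
      obtain rfl := Walk.eq_of_length_eq_zero hq
      -- For odd length the two halves add up to `w.length - 1 < r`, so the middle edge belongs to
      -- the ball and comes from an edge at `m`.
      have hadj : (H.halfBall r x).Adj m n' := by
        refine ((hb x).2 m (mem_halfBall_iff.2 ⟨w₁, by omega⟩) n'
          (mem_halfBall_iff.2 ⟨w', by omega⟩)).2 (halfBall_adj_iff.2 ⟨?_, w₁.map p, w'.map p, ?_⟩)
        · rw [hpn]
          exact p.map_adj h
        · simp only [Walk.length_map]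
          omega
      exact (hp m).injOn hadj.adj_sub h hpn
  subst hn
  have := hw'.reverse
  rw [Walk.reverse_reverse] at this
  exact hp.end_unique this (isLift_map w₂)

/-- Two walks from the centre within a ball have total length at most `r`. For an edge of a ball the
sum of distances is strictly below `r`, which leaves room for the edge itself. -/
theorem ClosesShortWalks.isBallPreserving (hp : IsLocalBijection p)
    (hs : ClosesShortWalks r p) : IsBallPreserving r p := by
  have hinj : ∀ {x a b : W} (w : H.Walk x a) (w' : H.Walk x b), w.length + w'.length ≤ r →
      p a = p b → a = b := fun w w' hl h =>
    hs (w.reverse.append w') (by simpa using hl) h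
  intro x
  refine ⟨⟨?_, ?_, ?_⟩, ?_⟩
  · intro a ha
    obtain ⟨w, hw⟩ := mem_halfBall_iff.1 ha
    exact mem_halfBall_iff.2 ⟨w.map p, by simpa using hw⟩
  · intro a ha b hb hab
    obtain ⟨w, hw⟩ := mem_halfBall_iff.1 ha
    obtain ⟨w', hw'⟩ := mem_halfBall_iff.1 hb
    exact hinj w w' (by omega) hab
  · intro b hb
    obtain ⟨w, hw⟩ := mem_halfBall_iff.1 hb
    obtain ⟨y, w', hw'⟩ := hp.exists_isLift w rfl
    exact ⟨y, mem_halfBall_iff.2 ⟨w', by rw [hw'.length_eq]; exact hw⟩, hw'.end_eq⟩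
  · intro a ha b hb
    constructor
    · intro h
      obtain ⟨h, w, w', h1, h2, h3⟩ := halfBall_adj_iff.1 h
      exact halfBall_adj_iff.2 ⟨p.map_adj h, w.map p, w'.map p, by simpa using h1,
        by simpa using h2, by simpa using h3⟩
    · intro h
      obtain ⟨h, w, w', h1, h2, h3⟩ := halfBall_adj_iff.1 h
      obtain ⟨w₁, hw₁⟩ := mem_halfBall_iff.1 ha
      obtain ⟨w₂, hw₂⟩ := mem_halfBall_iff.1 hb
      obtain ⟨a', v, hv⟩ := hp.exists_isLift w rfl
      obtain ⟨b', v', hv'⟩ := hp.exists_isLift w' rfl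
      have hlv := hv.length_eq
      have hlv' := hv'.length_eq
      have e1 : a' = a := hinj v w₁ (by omega) hv.end_eq
      have e2 : b' = b := hinj v' w₂ (by omega) hv'.end_eq
      subst e1 e2
      obtain ⟨c, hc, hpc⟩ := hp.exists_adj a' _ h
      have e3 : c = b' := hinj (v.concat hc) v' (by rw [Walk.length_concat]; omega) hpc
      subst e3
      exact halfBall_adj_iff.2 ⟨hc, v, v', by omega, by omega, by omega⟩

theorem IsCovering.isLocalBijection (hp : IsCovering p) : IsLocalBijection p :=
  hp.bijOn_neighborSet

theorem IsCovering.reachable (hp : IsCovering p) {x y : W} (h : G.Reachable (p x) (p y)) :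
    H.Reachable x y := by
  have hx : x ∈ p ⁻¹' (G.connectedComponentMk (p x)).supp := rfl
  have hy : y ∈ p ⁻¹' (G.connectedComponentMk (p x)).supp := ConnectedComponent.eq.2 h.symm
  exact ((hp.connected_preimage (G.connectedComponentMk (p x))).preconnected ⟨x, hx⟩
    ⟨y, hy⟩).map (Embedding.induce _).toHom

theorem IsLocalBijection.isCovering (hp : IsLocalBijection p) (hsurj : Function.Surjective p)
    (hreach : ∀ x y, G.Reachable (p x) (p y) → H.Reachable x y) : IsCovering p where
  surjective := hsurj
  bijOn_neighborSet := hp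
  connected_preimage C := by
    rw [connected_iff]
    constructor
    · rintro ⟨x, hx⟩ ⟨y, hy⟩
      obtain ⟨w⟩ := hreach x y (ConnectedComponent.eq.1 (Eq.trans hx (Eq.symm hy)))
      have hmem : ∀ t ∈ w.support, t ∈ p ⁻¹' C.supp := by
        classical
        intro t ht
        have h := Reachable.map p (w.takeUntil t ht).reachable
        exact Eq.trans (ConnectedComponent.eq.2 h.symm) hx
      exact (w.induce _ hmem).reachable
    · induction C using ConnectedComponent.ind with
      | h v =>
        obtain ⟨x, rfl⟩ := hsurj v
        exact ⟨⟨x, rfl⟩⟩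

end Lifts

/-! ### The `r`-local cover and its universal property -/

section Construction

variable {V : Type u} {G : SimpleGraph V} {r : ℕ}

/-- The vertices of the `r`-local cover: the `r`-homotopy classes of walks that start at the
representatives of the components. -/
def CoverVertex (G : SimpleGraph V) (r : ℕ) : Type u :=
  Σ (C : G.ConnectedComponent) (v : V), Quot (Walk.ShortStep r : G.Walk C.out v → G.Walk C.out v → Prop)

/-- The vertex of the `r`-local cover that is represented by a walk. -/
def CoverVertex.mk (r : ℕ) {C : G.ConnectedComponent} {v : V} (w : G.Walk C.out v) :
    G.CoverVertex r := ⟨C, v, Quot.mk _ w⟩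

theorem CoverVertex.exists_eq_mk (x : G.CoverVertex r) :
    ∃ (C : G.ConnectedComponent) (w : G.Walk C.out x.2.1), x = CoverVertex.mk r w := by
  obtain ⟨C, v, α⟩ := x
  obtain ⟨w, rfl⟩ := Quot.exists_rep α
  exact ⟨C, w, rfl⟩

theorem CoverVertex.mk_eq_mk_iff {C : G.ConnectedComponent} {v : V} {w w' : G.Walk C.out v} :
    CoverVertex.mk r w = CoverVertex.mk r w' ↔ w.ShortHomotopic r w' := by
  constructor
  · intro h
    have h1 := eq_of_heq (Sigma.mk.inj h).2
    exact Quot.eqvGen_exact (eq_of_heq (Sigma.mk.inj h1).2)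
  · intro h
    have : (Quot.mk (Walk.ShortStep r) w) = Quot.mk (Walk.ShortStep r) w' := Quot.eqvGen_sound h
    unfold CoverVertex.mk
    rw [this]

theorem CoverVertex.eq_of_mk_eq_mk {C C' : G.ConnectedComponent} {v v' : V} {w : G.Walk C.out v}
    {w' : G.Walk C'.out v'} (h : CoverVertex.mk r w = CoverVertex.mk r w') :
    C = C' ∧ v = v' := by
  obtain rfl : C = C' := (Sigma.mk.inj h).1
  exact ⟨rfl, congrArg (fun x : G.CoverVertex r => x.2.1) h⟩

/-- The adjacency of the `r`-local cover: extending a walk by an edge. -/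
def CoverAdj (G : SimpleGraph V) (r : ℕ) (x y : G.CoverVertex r) : Prop :=
  ∃ (C : G.ConnectedComponent) (a b : V) (w : G.Walk C.out a) (h : G.Adj a b),
    x = CoverVertex.mk r w ∧ y = CoverVertex.mk r (w.concat h)

theorem coverAdj_mk_iff {C : G.ConnectedComponent} {a : V} {w : G.Walk C.out a}
    {y : G.CoverVertex r} :
    G.CoverAdj r (CoverVertex.mk r w) y ↔
      ∃ (b : V) (h : G.Adj a b), y = CoverVertex.mk r (w.concat h) := by
  constructor
  · rintro ⟨C', a', b, w', h, hx, rfl⟩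
    obtain ⟨rfl, rfl⟩ := CoverVertex.eq_of_mk_eq_mk hx
    refine ⟨b, h, CoverVertex.mk_eq_mk_iff.2 ?_⟩
    rw [Walk.concat_eq_append, Walk.concat_eq_append]
    exact (CoverVertex.mk_eq_mk_iff.1 hx).symm.append_right _
  · rintro ⟨b, h, rfl⟩
    exact ⟨C, a, b, w, h, rfl, rfl⟩

/-- The `r`-local cover of `G`. -/
def localCover (G : SimpleGraph V) (hr : 2 ≤ r) : SimpleGraph (G.CoverVertex r) where
  Adj := G.CoverAdj r
  symm := ⟨by
    rintro _ _ ⟨C, a, b, w, h, rfl, rfl⟩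
    exact ⟨C, b, a, w.concat h, h.symm, rfl,
      (CoverVertex.mk_eq_mk_iff.2 (w.shortHomotopic_concat_concat hr h)).symm⟩⟩
  loopless := ⟨by
    rintro _ ⟨C, a, b, w, h, rfl, h'⟩
    exact h.ne (CoverVertex.eq_of_mk_eq_mk h').2⟩

/-- The projection of the `r`-local cover. -/
def localCoverProj (G : SimpleGraph V) (hr : 2 ≤ r) : G.localCover hr →g G where
  toFun x := x.2.1
  map_rel' := by
    rintro _ _ ⟨C, a, b, w, h, rfl, rfl⟩
    exact h

theorem localCoverProj_mk (hr : 2 ≤ r) {C : G.ConnectedComponent} {v : V} (w : G.Walk C.out v) :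
    G.localCoverProj hr (CoverVertex.mk r w) = v := rfl

theorem isLocalBijection_localCoverProj (hr : 2 ≤ r) : IsLocalBijection (G.localCoverProj hr) := by
  intro x
  obtain ⟨C, w, hx⟩ := x.exists_eq_mk
  generalize x.2.1 = a at w hx
  subst hx
  refine ⟨fun y hy => (G.localCoverProj hr).map_adj hy, ?_, ?_⟩
  · intro y hy y' hy' h
    obtain ⟨b, hb, rfl⟩ := coverAdj_mk_iff.1 hy
    obtain ⟨b', hb', rfl⟩ := coverAdj_mk_iff.1 hy'
    obtain rfl : b = b' := h
    rfl
  · intro b hb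
    exact ⟨CoverVertex.mk r (w.concat hb), coverAdj_mk_iff.2 ⟨b, hb, rfl⟩, rfl⟩

/-- Lifting from the class of `w` is appending to `w`: the successive vertices of the lift are the
classes of `w` extended by initial segments of `w'`. -/
theorem exists_isLift_localCoverProj (hr : 2 ≤ r) {C : G.ConnectedComponent} {a b : V} (w : G.Walk C.out a)
    (w' : G.Walk a b) : ∃ v : (G.localCover hr).Walk (CoverVertex.mk r w)
      (CoverVertex.mk r (w.append w')), IsLift (G.localCoverProj hr) v w' := by
  induction w' with
  | nil =>
    rw [Walk.append_nil]
    exact ⟨.nil, rfl⟩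
  | @cons a s b h q ih =>
    have hadj : (G.localCover hr).Adj (CoverVertex.mk r w) (CoverVertex.mk r (w.concat h)) :=
      coverAdj_mk_iff.2 ⟨s, h, rfl⟩
    have ih' := ih (w.concat h)
    rw [Walk.concat_append] at ih'
    obtain ⟨v, hv⟩ := ih'
    refine ⟨.cons hadj v, ?_⟩
    unfold IsLift at *
    rw [Walk.support_cons, List.map_cons, hv, localCoverProj_mk, Walk.support_cons]

/-- If a short walk in the cover has a closed image, its ends are the classes of `w` and of `w`
followed by that image, which differ by one elementary homotopy. -/
theorem closesShortWalks_localCoverProj (hr : 2 ≤ r) : ClosesShortWalks r (G.localCoverProj hr) := by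
  intro x y v hv hxy
  obtain ⟨C, w, hx⟩ := x.exists_eq_mk
  obtain ⟨w', hw'⟩ : ∃ w' : G.Walk (G.localCoverProj hr x) (G.localCoverProj hr y),
    IsLift (G.localCoverProj hr) v w' := ⟨_, isLift_map v⟩
  change G.Walk C.out (G.localCoverProj hr x) at w
  change x = CoverVertex.mk r w at hx
  generalize G.localCoverProj hr y = b at w' hw' hxy
  generalize G.localCoverProj hr x = a at w w' hw' hxy hx
  subst hxy hx
  obtain ⟨v', hv'⟩ := exists_isLift_localCoverProj hr w w'
  rw [(isLocalBijection_localCoverProj hr).end_unique hw' hv', CoverVertex.mk_eq_mk_iff]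
  have := Walk.ShortHomotopic.of_length_le (r := r) w (l := w') (hw'.length_eq.symm.trans_le hv)
    .nil
  simp only [Walk.append_nil] at this
  exact this.symm

theorem reachable_mk_nil (hr : 2 ≤ r) (x : G.CoverVertex r) :
    ∃ C : G.ConnectedComponent, G.connectedComponentMk x.2.1 = C ∧
      (G.localCover hr).Reachable (CoverVertex.mk r (Walk.nil : G.Walk C.out C.out)) x := by
  obtain ⟨C, w, hx⟩ := x.exists_eq_mk
  refine ⟨C, ?_, ?_⟩
  · rw [← ConnectedComponent.eq.2 w.reachable]
    exact Quot.out_eq C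
  · obtain ⟨v, -⟩ := exists_isLift_localCoverProj hr Walk.nil w
    rw [Walk.nil_append, ← hx] at v
    exact v.reachable

theorem isCovering_localCoverProj (hr : 2 ≤ r) : IsCovering (G.localCoverProj hr) := by
  refine (isLocalBijection_localCoverProj hr).isCovering ?_ ?_
  · intro v
    have h : G.Reachable (G.connectedComponentMk v).out v :=
      ConnectedComponent.exact (Quot.out_eq (G.connectedComponentMk v))
    obtain ⟨w⟩ := h
    exact ⟨CoverVertex.mk r w, rfl⟩
  · intro x y h
    obtain ⟨C, hC, hx⟩ := reachable_mk_nil hr x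
    obtain ⟨C', hC', hy⟩ := reachable_mk_nil hr y
    obtain rfl : C = C' := hC.symm.trans ((ConnectedComponent.eq.2 h).trans hC')
    exact hx.symm.trans hy

/-- That the lift is closed means that `w₀` and `w₀` followed by `w` are `r`-homotopic; then `w₀` is
cancelled. -/
theorem shortHomotopic_nil_of_isLift (hr : 2 ≤ r) {x : G.CoverVertex r} (v : (G.localCover hr).Walk x x) {a : V}
    (w : G.Walk a a) (h : IsLift (G.localCoverProj hr) v w) : w.ShortHomotopic r .nil := by
  obtain ⟨C, w₀, hx⟩ := x.exists_eq_mk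
  have ha : x.2.1 = a := h.start_eq
  generalize x.2.1 = a' at w₀ hx ha
  subst hx ha
  obtain ⟨v', hv'⟩ := exists_isLift_localCoverProj hr w₀ w
  have h1 := (isLocalBijection_localCoverProj hr).end_unique h hv'
  have h2 := (CoverVertex.mk_eq_mk_iff.1 h1).symm.append_left w₀.reverse
  have h3 := w₀.reverse_append_shortHomotopic_nil hr
  rw [Walk.append_assoc] at h2
  have h4 := h3.append_right w
  rw [Walk.nil_append] at h4
  exact h4.symm.trans (h2.trans h3)

/-- The endpoint of a lift of a walk. -/
noncomputable def liftEnd {W : Type u} {H : SimpleGraph W} {p : H →g G} (hp : IsLocalBijection p)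
    {a b : V} {x : W} (hx : p x = a) (w : G.Walk a b) : W := (hp.exists_isLift w hx).choose

theorem liftEnd_spec {W : Type u} {H : SimpleGraph W} {p : H →g G} (hp : IsLocalBijection p)
    {a b : V} {x : W} (hx : p x = a) (w : G.Walk a b) :
    ∃ v : H.Walk x (liftEnd hp hx w), IsLift p v w := (hp.exists_isLift w hx).choose_spec

theorem liftEnd_eq {W : Type u} {H : SimpleGraph W} {p : H →g G} (hp : IsLocalBijection p)
    {a b : V} {x y : W} (hx : p x = a) {w : G.Walk a b} {v : H.Walk x y} (h : IsLift p v w) :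
    liftEnd hp hx w = y := by
  obtain ⟨v', hv'⟩ := liftEnd_spec hp hx w
  exact hp.end_unique hv' h

/-- The `r`-local cover covers every ball-preserving covering. -/
theorem exists_isCovering_localCover (hr : 2 ≤ r) {W : Type u} {H : SimpleGraph W} {p : H →g G}
    (hcov : IsCovering p) (hball : IsBallPreserving r p) :
    ∃ q : G.localCover hr →g H, IsCovering q ∧ G.localCoverProj hr = p.comp q := by
  have hp := hcov.isLocalBijection
  have hs := hball.closesShortWalks hp
  -- With one point fixed above each base point, the class of a walk goes to the end of the lift of
  -- that walk; lifted homotopies make this well defined.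
  choose base hbase using fun C : G.ConnectedComponent => hcov.surjective C.out
  let f : G.CoverVertex r → W := fun x => Quot.lift
    (fun w : G.Walk x.1.out x.2.1 => liftEnd hp (hbase x.1) w) (by
      intro w w' h
      obtain ⟨v, hv⟩ := liftEnd_spec hp (hbase x.1) w
      obtain ⟨v', hv'⟩ := liftEnd_spec hp (hbase x.1) w'
      exact (Walk.ShortHomotopic.lift hp hs (Relation.EqvGen.rel _ _ h) hv hv').1) x.2.2
  have hf : ∀ {C : G.ConnectedComponent} {a : V} (w : G.Walk C.out a),
      f (CoverVertex.mk r w) = liftEnd hp (hbase C) w := fun _ => rfl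
  have hpf : ∀ x, p (f x) = G.localCoverProj hr x := by
    intro x
    obtain ⟨C, w, hx⟩ := x.exists_eq_mk
    rw [hx, hf]
    obtain ⟨v, hv⟩ := liftEnd_spec hp (hbase C) w
    exact hv.end_eq
  have hadj : ∀ x y, (G.localCover hr).Adj x y → H.Adj (f x) (f y) := by
    rintro _ _ ⟨C, a, b, w, h, rfl, rfl⟩
    obtain ⟨v, hv⟩ := liftEnd_spec hp (hbase C) w
    obtain ⟨y, hy, rfl⟩ := hp.exists_adj _ b (hv.end_eq.symm ▸ h)
    have : IsLift p (v.concat hy) (w.concat h) := by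
      unfold IsLift at *
      rw [Walk.support_concat, Walk.support_concat, List.map_append, hv]
      rfl
    rw [hf, hf, liftEnd_eq hp (hbase C) this]
    exact hy
  let q : G.localCover hr →g H := ⟨f, fun h => hadj _ _ h⟩
  have hq : G.localCoverProj hr = p.comp q := RelHom.ext fun x => (hpf x).symm
  have hc := isLocalBijection_localCoverProj (G := G) hr
  have hqb : IsLocalBijection q := by
    intro x
    refine ⟨fun y hy => q.map_adj hy, ?_, ?_⟩
    · intro y hy y' hy' h
      refine (hc x).injOn hy hy' ?_
      rw [← hpf, ← hpf]
      exact congrArg p h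
    · intro z hz
      obtain ⟨y, hy, hyz⟩ := hc.exists_adj x (p z) (hpf x ▸ p.map_adj hz)
      refine ⟨y, hy, (hp (q x)).injOn (q.map_adj hy) hz ?_⟩
      exact (hpf y).trans hyz
  refine ⟨q, hqb.isCovering ?_ ?_, hq⟩
  · intro z
    set C := G.connectedComponentMk (p z)
    have h : G.Reachable (p (base C)) (p z) := by
      rw [hbase]
      exact ConnectedComponent.exact (Quot.out_eq C)
    obtain ⟨v⟩ := hcov.reachable h
    have hv : IsLift p v ((v.map p).copy (hbase C) rfl) := by
      unfold IsLift
      rw [Walk.support_copy, Walk.support_map]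
    exact ⟨CoverVertex.mk r ((v.map p).copy (hbase C) rfl), liftEnd_eq hp (hbase C) hv⟩
  · intro x y h
    refine (isCovering_localCoverProj hr).reachable ?_
    have := Reachable.map p h
    change G.Reachable (p (f x)) (p (f y)) at this
    rwa [hpf, hpf] at this

theorem isLocalCovering_localCoverProj (hr : 2 ≤ r) : IsLocalCovering r (G.localCoverProj hr) where
  isCovering := isCovering_localCoverProj hr
  isBallPreserving :=
    (closesShortWalks_localCoverProj hr).isBallPreserving (isLocalBijection_localCoverProj hr)
  universal _ _ _ hp hb := exists_isCovering_localCover hr hp hb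

/-- Closed walks in an `r`-local cover are `r`-homotopic to constant walks. -/
theorem IsLocalCovering.shortHomotopic_nil (hr : 2 ≤ r) {W : Type u} {H : SimpleGraph W} {p : H →g G}
    (hp : IsLocalCovering r p) {z : W} (c : H.Walk z z) : c.ShortHomotopic r .nil := by
  -- The given covering factors through the constructed one. So the projection to `G` of a closed
  -- walk has a closed lift in the constructed cover and is null-homotopic; this homotopy is then
  -- lifted to `H`.
  obtain ⟨q, -, rfl⟩ := hp.universal _ (G.localCover hr) (G.localCoverProj hr)
    (isCovering_localCoverProj hr) (isLocalCovering_localCoverProj hr).isBallPreserving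
  have hb := hp.isCovering.isLocalBijection
  have h := shortHomotopic_nil_of_isLift hr (c.map q) (c.map ((G.localCoverProj hr).comp q)) (by
    unfold IsLift
    rw [Walk.support_map, Walk.support_map, List.map_map]
    rfl)
  exact (h.lift hb (hp.isBallPreserving.closesShortWalks hb) (isLift_map c) isLift_nil).2

end Construction

/-! ### Passing chordality and wheel-freeness between a graph and its covers -/

section Transfer

variable {W : Type u} {V : Type v} {H : SimpleGraph W} {G : SimpleGraph V} {r : ℕ}

theorem IsChordal.of_embedding (hG : G.IsChordal) (f : H ↪g G) : H.IsChordal := by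
  intro z c hc h4
  obtain ⟨a, ha, b, hb, hab, hnot⟩ := hG _ (c.map f.toHom)
    ((Walk.isCycle_map_iff_of_injective f.injective).2 hc) (by simpa using h4)
  rw [Walk.support_map, List.mem_map] at ha hb
  obtain ⟨a, ha, rfl⟩ := ha
  obtain ⟨b, hb, rfl⟩ := hb
  refine ⟨a, ha, b, hb, f.map_adj_iff.1 hab, fun h => hnot ?_⟩
  rw [Walk.edges_map]
  exact List.mem_map.2 ⟨_, h, rfl⟩

/-- Chordality passes to a graph whose edges all come from an induced subgraph. -/
theorem IsChordal.of_embedding_of_range (hH : H.IsChordal) (f : H ↪g G)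
    (hf : ∀ u v, G.Adj u v → u ∈ Set.range f) : G.IsChordal := by
  intro z c hc h4
  obtain ⟨x, rfl⟩ : z ∈ Set.range f := hf _ _ (c.adj_snd hc.not_nil)
  obtain ⟨y, w, hw⟩ := exists_isLift (p := f.toHom) (fun x b h => by
    obtain ⟨y, rfl⟩ := hf _ _ h.symm
    exact ⟨y, f.map_adj_iff.1 h, rfl⟩) c (x := x) rfl
  obtain rfl : y = x := f.injective hw.end_eq
  obtain rfl : c = w.map f.toHom := Walk.ext_support (by rw [Walk.support_map]; exact hw.symm)
  obtain ⟨a, ha, b, hb, hab, hnot⟩ := hH _ w hc.of_map (by simpa using h4)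
  refine ⟨f a, ?_, f b, ?_, f.map_adj_iff.2 hab, ?_⟩
  · rw [Walk.support_map]
    exact List.mem_map.2 ⟨a, ha, rfl⟩
  · rw [Walk.support_map]
    exact List.mem_map.2 ⟨b, hb, rfl⟩
  · rw [Walk.edges_map, List.mem_map]
    rintro ⟨e, he, h⟩
    have : e = s(a, b) := Sym2.map.injective f.injective h
    exact hnot (this ▸ he)

/-- The two graphs differ only by isolated vertices. -/
theorem isChordal_coe_iff (S : G.Subgraph) : S.coe.IsChordal ↔ S.spanningCoe.IsChordal := by
  let f : S.coe ↪g S.spanningCoe := ⟨⟨Subtype.val, Subtype.val_injective⟩, Iff.rfl⟩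
  exact ⟨fun h => h.of_embedding_of_range f fun u v huv => ⟨⟨u, S.edge_vert huv⟩, rfl⟩,
    fun h => h.of_embedding f⟩

variable {p : H →g G}

theorem IsBallPreserving.isLocallyChordal (hp : IsBallPreserving r p)
    (hsurj : Function.Surjective p) (hH : H.IsLocallyChordal r) : G.IsLocallyChordal r := by
  intro v
  obtain ⟨x, rfl⟩ := hsurj v
  obtain ⟨hbij, hadj⟩ := hp x
  let f : (H.halfBall r x).coe ↪g (G.halfBall r (p x)).coe :=
    ⟨⟨fun a => ⟨p a.1, hbij.mapsTo a.2⟩, fun a b h =>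
      Subtype.ext (hbij.injOn a.2 b.2 (congrArg Subtype.val h))⟩,
      fun {a b} => (hadj a.1 a.2 b.1 b.2).symm⟩
  refine (hH x).of_embedding_of_range f fun u _ _ => ?_
  obtain ⟨a, ha, h⟩ := hbij.surjOn u.2
  exact ⟨⟨a, ha⟩, Subtype.ext h⟩

theorem ClosesShortWalks.adj (hp : IsLocalBijection p) (hs : ClosesShortWalks r p) {a b : W}
    (w : H.Walk a b) (hw : w.length + 1 ≤ r) (h : G.Adj (p a) (p b)) : H.Adj a b := by
  obtain ⟨y, hy, hyb⟩ := hp.exists_adj a _ h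
  obtain rfl := hs (Walk.cons hy.symm w) (by simpa using hw) hyb
  exact hy

/-- Subwalks of a short cycle are short, so its image is again a cycle. The ends of a chord of the
image are joined by a proper subwalk upstairs, hence the chord lifts. -/
theorem ClosesShortWalks.isLengthChordal (hp : IsLocalBijection p) (hs : ClosesShortWalks r p)
    (hG : G.IsLengthChordal r) : H.IsLengthChordal r := by
  intro z c hc h4 hr
  have hcyc : (c.map p).IsCycle := by
    rw [Walk.isCycle_iff_isPath_tail_and_le_length, ← Walk.IsPath.getVert_injOn_iff]
    refine ⟨?_, by simp; omega⟩
    have key : ∀ i j, i < j → j < c.length → p (c.getVert (i + 1)) = p (c.getVert (j + 1)) →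
        False := by
      intro i j hij hj h
      obtain ⟨-, q, -, -, -, hq, -⟩ := c.exists_eq_append_append (i := i + 1) (j := j + 1)
        (by omega) (by omega) rfl rfl
      have := hc.getVert_injOn (by simp; omega) (by simp; omega) (hs q (by omega) h)
      omega
    intro i hi j hj h
    simp only [Walk.length_tail, Walk.length_map, Set.mem_ofPred_eq] at hi hj
    simp only [Walk.getVert_tail, Walk.getVert_map] at h
    rcases lt_trichotomy i j with hlt | rfl | hlt
    · exact (key i j hlt (by omega) h).elim
    · rfl
    · exact (key j i hlt (by omega) h.symm).elim
  obtain ⟨a, ha, b, hb, hab, hnot⟩ := hG _ _ hcyc (by simpa using h4) (by simpa using hr)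
  rw [Walk.support_map, List.mem_map] at ha hb
  obtain ⟨a, ha, rfl⟩ := ha
  obtain ⟨b, hb, rfl⟩ := hb
  obtain ⟨i, rfl, hi⟩ := Walk.mem_support_iff_exists_getVert.1 ha
  obtain ⟨j, rfl, hj⟩ := Walk.mem_support_iff_exists_getVert.1 hb
  have key : ∀ i j, i < j → j ≤ c.length → G.Adj (p (c.getVert i)) (p (c.getVert j)) →
      H.Adj (c.getVert i) (c.getVert j) := by
    intro i j hij hj h
    obtain ⟨-, q, -, -, -, hq, -⟩ := c.exists_eq_append_append hij.le hj rfl rfl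
    refine hs.adj hp q ?_ h
    have : ¬ (i = 0 ∧ j = c.length) := by
      rintro ⟨rfl, rfl⟩
      simp at h
    omega
  refine ⟨_, ha, _, hb, ?_, fun h => hnot ?_⟩
  · rcases lt_trichotomy i j with hlt | rfl | hlt
    · exact key i j hlt hj hab
    · exact absurd hab (G.loopless.irrefl _)
    · exact (key j i hlt hi hab.symm).symm
  · rw [Walk.edges_map]
    exact List.mem_map.2 ⟨_, h, rfl⟩

theorem ClosesShortWalks.isWheelFree (hr : 3 ≤ r) (hp : IsLocalBijection p)
    (hs : ClosesShortWalks r p) (hG : G.IsWheelFree) : H.IsWheelFree := by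
  rintro n hn ⟨f⟩
  have hub : ∀ i, H.Adj (f none) (f (some i)) := fun i => f.map_adj_iff.2 trivial
  have hw : ∀ i j, ∃ w : H.Walk (f i) (f j), w.length + 1 ≤ r := by
    rintro (_ | i) (_ | j)
    · exact ⟨.nil, by simp; omega⟩
    · exact ⟨.cons (hub j) .nil, by simp; omega⟩
    · exact ⟨.cons (hub i).symm .nil, by simp; omega⟩
    · exact ⟨.cons (hub i).symm (.cons (hub j) .nil), by simpa using hr⟩
  refine hG n hn ⟨⟨⟨fun i => p (f i), fun i j h => ?_⟩, fun {i j} => ?_⟩⟩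
  · obtain ⟨w, hl⟩ := hw i j
    exact f.injective (hs w (by omega) h)
  · obtain ⟨w, hl⟩ := hw i j
    exact ⟨fun h => f.map_adj_iff.1 (hs.adj hp w hl h), fun h => p.map_adj (f.map_adj_iff.2 h)⟩

end Transfer

/-! ### Local chordality against chordality, short cycles and wheels -/

section LocallyChordal

variable {V : Type u} {G : SimpleGraph V} {r : ℕ}

/-- A cycle of length at most `r` lies in the ball around its base `z`: going the shorter way round,
the distances from `z` to the ends of an edge add up to less than `r`. -/
theorem IsLocallyChordal.isLengthChordal (hG : G.IsLocallyChordal r) : G.IsLengthChordal r := by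
  intro z c hc h4 hr
  have hB := (isChordal_coe_iff _).1 (hG z)
  have hedges : ∀ e ∈ c.edges, e ∈ (G.halfBall r z).spanningCoe.edgeSet := by
    intro e he
    induction e with
    | _ a b =>
    obtain ⟨i, hi, h⟩ := c.mk_mem_edges_iff_exists.1 he
    rw [← h]
    change (G.halfBall r z).Adj _ _
    refine halfBall_adj_iff.2 ⟨c.adj_getVert_succ hi, ?_⟩
    obtain ⟨w₁, w₂, -, h1, h2⟩ := c.exists_eq_append hi.le rfl
    obtain ⟨w₃, w₄, -, h3, h4⟩ := c.exists_eq_append (Nat.succ_le_of_lt hi) rfl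
    rcases Nat.lt_or_ge (2 * i) c.length with hlt | hge
    · rcases Nat.lt_or_ge c.length (2 * i + 2) with hlt' | hge'
      · refine ⟨w₁, w₄.reverse, ?_⟩
        rw [Walk.length_reverse]
        omega
      · exact ⟨w₁, w₃, by omega⟩
    · refine ⟨w₂.reverse, w₄.reverse, ?_⟩
      rw [Walk.length_reverse, Walk.length_reverse]
      omega
  obtain ⟨a, ha, b, hb, hab, hnot⟩ := hB z (c.transfer _ hedges) (hc.transfer hedges)
    (by simpa using h4)
  rw [Walk.support_transfer] at ha hb
  rw [Walk.edges_transfer] at hnot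
  exact ⟨a, ha, b, hb, Subgraph.spanningCoe_le _ hab, hnot⟩

/-- As `1 + 1 < r`, the rim lies in the ball around the hub. Chordality would link the rim
neighbours 2 and 0 of vertex 1 through neighbours of 1 on the rest of the rim, but 1 has no others
there. -/
theorem IsLocallyChordal.isWheelFree (hr : 3 ≤ r) (hG : G.IsLocallyChordal r) :
    G.IsWheelFree := by
  rintro n hn ⟨f⟩
  have hub : ∀ i, G.Adj (f none) (f (some i)) := fun i => f.map_adj_iff.2 trivial
  set B := (G.halfBall r (f none)).spanningCoe with hBdef
  have hB : B.IsChordal := (isChordal_coe_iff _).1 (hG _)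
  have rim : ∀ i j : Fin n, B.Adj (f (some i)) (f (some j)) ↔
      ((i : ℕ) + 1 = j ∨ (j : ℕ) + 1 = i ∨ ((i : ℕ) = 0 ∧ (j : ℕ) + 1 = n) ∨
      ((j : ℕ) = 0 ∧ (i : ℕ) + 1 = n)) := fun i j => by
    rw [← cycleGraph_adj_iff i j (by omega)]
    have h : G.Adj (f (some i)) (f (some j)) ↔ (cycleGraph n).Adj i j := f.map_adj_iff
    rw [← h]
    refine ⟨fun h => Subgraph.spanningCoe_le _ h, fun h => halfBall_adj_iff.2 ⟨h, .cons (hub i) .nil,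
      .cons (hub j) .nil, ?_⟩⟩
    simp only [Walk.length_cons, Walk.length_nil]
    omega
  let i0 : Fin n := ⟨0, by omega⟩
  let i1 : Fin n := ⟨1, by omega⟩
  let i2 : Fin n := ⟨2, by omega⟩
  set S : Set V := {t | ∃ j : Fin n, (j : ℕ) ≠ 1 ∧ t = f (some j)} with hS
  have chain : ∀ k, 2 ≤ k → ∀ hk : k < n,
      (B.restrictTo S).Reachable (f (some i2)) (f (some ⟨k, hk⟩)) := by
    intro k hk
    induction k, hk using Nat.le_induction with
    | base => exact fun _ => Reachable.refl _
    | succ k hk ih =>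
      intro hk'
      refine (ih (by omega)).trans (Adj.reachable ⟨(rim _ _).2 (by simp), ⟨_, ?_, rfl⟩, _, ?_, rfl⟩)
      · exact fun h => by simp at h; omega
      · exact fun h => by simp at h; omega
  have hreach : (B.restrictTo S).Reachable (f (some i2)) (f (some i0)) := by
    refine (chain (n - 1) (by omega) (by omega)).trans (Adj.reachable
      ⟨(rim _ _).2 ?_, ⟨_, ?_, rfl⟩, i0, by simp [i0], rfl⟩)
    · exact Or.inr (Or.inr (Or.inr ⟨rfl, Nat.sub_add_cancel (by omega)⟩))
    · exact fun h => by simp at h; omega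
  have h := hB.reachable_inter_neighborSet (v := f (some i1)) (S := S) (by
      rintro ⟨j, hj, h⟩
      have : i1 = j := by simpa using f.injective h
      exact hj (by rw [← this])) ⟨i2, by simp [i2], rfl⟩ ((rim _ _).2 (by simp [i1, i2]))
    ((rim _ _).2 (by simp [i1, i0])) hreach
  obtain ⟨_, h1, ⟨⟨j, hj, rfl⟩, h2⟩, h3, -⟩ := h.exists_adj_avoiding (fun h => by
    have : i2 = i0 := by simpa using f.injective h
    simp [i2, i0] at this)
  have h1' := (rim _ _).1 h1
  have h2' := (rim _ _).1 h2
  have h3' : (j : ℕ) ≠ 0 := fun h => h3 (by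
    have : j = i0 := Fin.ext h
    rw [this])
  simp only [i0, i1] at h1' h2'
  omega

theorem IsChordal.isLocallyChordal (hG : G.IsChordal) (r : ℕ) : G.IsLocallyChordal r := by
  classical
  intro x
  rw [isChordal_coe_iff]
  set B := (G.halfBall r x).spanningCoe with hBdef
  have hle : B ≤ G := Subgraph.spanningCoe_le _
  intro z c hc h4
  by_contra hcon
  push Not at hcon
  obtain ⟨a, ha, b, hb, hab, hnot⟩ := hG z (c.mapLe hle) (hc.mapLe _) (by simpa using h4)
  simp only [Walk.support_mapLe_eq_support, Walk.edges_mapLe_eq_edges] at ha hb hnot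
  have hball : ∀ t ∈ c.support, 2 * G.edist x t ≤ r := fun t ht =>
    (G.halfBall r x).edge_vert ((c.rotate _ ht).adj_snd (Walk.IsCycle.rotate ht hc).not_nil)
  have hnat : ∀ t ∈ c.support, ∃ n : ℕ, G.edist x t = n := by
    intro t ht
    obtain ⟨w, hw⟩ := mem_halfBall_iff.1 (hball t ht)
    exact ⟨_, (ENat.natCast_toNat (ne_top_of_le_ne_top (ENat.natCast_ne_top _) w.edist_le)).symm⟩
  have hadjB : ∀ s t, s ∈ c.support → t ∈ c.support → G.Adj s t →
      G.edist x s + G.edist x t < r → B.Adj s t := fun s t hs ht h hlt =>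
    ⟨h, hball s hs, hball t ht, hlt⟩
  have hBab : ¬ B.Adj a b := fun h => hnot (hcon a ha b hb h)
  obtain ⟨k, hk⟩ := hnat a ha
  -- A chord in `G` missing from the ball has both ends at distance exactly `r / 2`. Both cycle
  -- neighbours of `a` are then one step closer to `x`.
  have hkr : 2 * k = r := by
    obtain ⟨l, hl⟩ := hnat b hb
    have h1 := hball a ha
    have h2 := hball b hb
    have h3 : ¬ G.edist x a + G.edist x b < r := fun h => hBab (hadjB a b ha hb hab h)
    rw [hk] at h1 h3
    rw [hl] at h2 h3
    norm_cast at h1 h2 h3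
    omega
  have hlevel : ∀ u, u ∈ c.support → B.Adj a u → ∃ n : ℕ, G.edist x u = n ∧ n + 1 = k := by
    intro u hu hau
    obtain ⟨n, hn⟩ := hnat u hu
    refine ⟨n, hn, ?_⟩
    have h1 := hau.2.2.2
    have h2 : G.edist x a ≤ G.edist x u + 1 := by
      refine (G.edist_triangle (v := u)).trans ?_
      gcongr
      rw [edist_eq_one_iff_adj.2 (hle hau).symm]
    rw [hk, hn] at h1 h2
    norm_cast at h1 h2
    omega
  set c' := c.rotate a ha with hc'def
  have hc' : c'.IsCycle := Walk.IsCycle.rotate ha hc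
  have hl : 4 ≤ c'.length := by simpa [hc'def] using h4
  have hsup : ∀ t, t ∈ c'.support → t ∈ c.support := fun t ht => by
    simpa [hc'def] using ht
  have hu := hsup _ (c'.getVert_mem_support 1)
  have hw := hsup _ (c'.getVert_mem_support (c'.length - 1))
  have hau : B.Adj a c'.snd := c'.adj_snd hc'.not_nil
  have haw : B.Adj a c'.penultimate := (c'.adj_penultimate hc'.not_nil).symm
  obtain ⟨m, hm, hmk⟩ := hlevel _ hu hau
  obtain ⟨m', hm', hmk'⟩ := hlevel _ hw haw
  obtain rfl : m = m' := by omega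
  have hne := hc'.snd_ne_penultimate
  generalize hus : c'.snd = u at *
  generalize hws : c'.penultimate = w at *
  change G.edist x c'.snd = m at hm
  change G.edist x c'.penultimate = m at hm'
  change c'.snd ∈ c.support at hu
  change c'.penultimate ∈ c.support at hw
  rw [hus] at hm hu
  rw [hws] at hm' hw
  -- `S` joins `u` to `w` via the centre, and it contains no neighbours of `a` besides these two, as
  -- all its other vertices have distance below `k - 1`. So `u` and `w` are adjacent, and their edge
  -- is in the ball, a chord of the cycle.
  set S : Set V := {t | G.edist x t < m ∨ t = u ∨ t = w} with hS
  have hr : ∀ s ∈ S, G.edist x s = m → (G.restrictTo S).Reachable x s := by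
    intro s hs hsm
    obtain ⟨q, hq⟩ := exists_walk_of_edist_eq_coe hsm
    refine q.reachable_restrictTo fun t ht => ?_
    obtain ⟨i, rfl, hi⟩ := Walk.mem_support_iff_exists_getVert.1 ht
    rcases hi.lt_or_eq with hi | rfl
    · left
      obtain ⟨q', -, -, hq', -⟩ := q.exists_eq_append hi.le rfl
      refine q'.edist_le.trans_lt ?_
      rw [hq', ← hq]
      exact_mod_cast hi
    · rwa [Walk.getVert_length]
  have huS : u ∈ S := Or.inr (Or.inl rfl)
  have hwS : w ∈ S := Or.inr (Or.inr rfl)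
  have haS : a ∉ S := by
    rintro (h | rfl | rfl)
    · rw [hk] at h
      norm_cast at h
      omega
    · exact hau.ne rfl
    · exact haw.ne rfl
  have hreach := hG.reachable_inter_neighborSet haS huS (hle hau) (hle haw)
    ((hr u huS hm).symm.trans (hr w hwS hm'))
  obtain ⟨t, ht1, ⟨ht2, ht3⟩, ht4, -⟩ := hreach.exists_adj_avoiding hne
  have htu : t = u := by
    rcases ht2 with h | h | h
    · have h2 : G.edist x a ≤ G.edist x t + 1 := by
        refine (G.edist_triangle (v := t)).trans ?_
        gcongr
        rw [edist_eq_one_iff_adj.2 (SimpleGraph.Adj.symm ht3)]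
      obtain ⟨n, hn⟩ : ∃ n : ℕ, G.edist x t = n :=
        ⟨_, (ENat.natCast_toNat (ne_top_of_lt h)).symm⟩
      rw [hk, hn] at h2
      rw [hn] at h
      norm_cast at h2 h
      omega
    · exact h
    · exact absurd h ht4
  subst htu
  have hB : B.Adj t w := hadjB t w hu hw ht1 (by
    rw [hm, hm']
    norm_cast
    omega)
  have hmem := hcon t hu w hw hB
  have := hc'.snd_penultimate_notMem_edges hl
  rw [hus, hws, hc'def] at this
  exact this ((c.rotate_edges a ha).mem_iff.2 hmem)

end LocallyChordal

end SimpleGraph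

theorem theorem1 {V : Type u} (G : SimpleGraph V) (r : ℕ) (hr : 3 ≤ r) :
    (∃ (W : Type u) (H : SimpleGraph W) (p : H →g G), SimpleGraph.IsLocalCovering r p) ∧
    ∀ (W : Type u) (H : SimpleGraph W) (p : H →g G), SimpleGraph.IsLocalCovering r p →
      List.TFAE [
        G.IsLocallyChordal r,
        G.IsLengthChordal r ∧ G.IsWheelFree,
        H.IsChordal,
        ∀ X : Set V, G.IsMinimalLocalSeparator r X → G.IsClique X] := by
  have hr2 : 2 ≤ r := by omega
  refine ⟨⟨_, G.localCover hr2, G.localCoverProj hr2,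
    SimpleGraph.isLocalCovering_localCoverProj hr2⟩, fun W H p hp => ?_⟩
  have hb := hp.isCovering.isLocalBijection
  have hs := hp.isBallPreserving.closesShortWalks hb
  tfae_have 1 → 2 := fun h => ⟨h.isLengthChordal, h.isWheelFree hr⟩
  tfae_have 2 → 3 := fun ⟨h1, h2⟩ =>
    SimpleGraph.isChordal_of_shortHomotopic_nil (hs.isLengthChordal hb h1)
      (hs.isWheelFree hr hb h2).isChordal_neighborSet fun _ c => hp.shortHomotopic_nil hr2 c
  tfae_have 3 → 1 := fun h =>
    hp.isBallPreserving.isLocallyChordal hp.isCovering.surjective (h.isLocallyChordal r)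
  tfae_have 2 → 4 := fun ⟨h1, h2⟩ _ hX => hX.isClique hr h1 h2.isChordal_neighborSet
  tfae_have 4 → 2 := fun h => ⟨SimpleGraph.isLengthChordal_of_isClique_minimal h,
    SimpleGraph.isWheelFree_of_isClique_minimal hr h⟩
  tfae_finish
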